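/- Let $\mathbb H$ be the quaternions, $\mathbb S=\{I\in\mathbb H: I^2=-1\}$, $\mathbb C_I=\mathbb R+I\mathbb R$ for $I\in\mathbb S$, and $N\ge 1$ an integer. A function $f:\mathbb H\to\mathbb H$ is called slice polyanalytic of order $N$ if - it is a slice function, i.e. there are $\alpha,\beta:\mathbb R^2\to\mathbb H$ with $\alpha(x,-y)=\alpha(x,y)$, $\beta(x,-y)=-\beta(x,y)$ and $f(x+Iy)=\alpha(x,y)+I\beta(x,y)$ for all $x,y\in\mathbb R$ and $I\in\mathbb S$; - it is $N$ times real differentiable on $\mathbb H$; - $\frac1{2^N}\left(\frac{\partial}{\partial x}+I\frac{\partial}{\partial y}\right)^N f(x+Iy)=0$ for all $I\in\mathbb S$ and $x,y\in\mathbb R$. For $I\in\mathbb S$ let $\mathcal F^N_I(\mathbb H)$ be the set of all slice polyanalytic functions $f$ of order $N$ on $\mathbb H$ with $\int_{\mathbb R^2}|f(x+Iy)|^2e^{-(x^2+y^2)}\,dx\,dy<\infty$, and put $$\langle f,g\rangle_I=\int_{\mathbb R^2}\overline{g(x+Iy)}\,f(x+Iy)\,e^{-(x^2+y^2)}\,dx\,dy,\qquad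 \|f\|_I=\langle f,f\rangle_I^{1/2}.$$ Then, for every $N\ge1$ and every $I\in\mathbb S$: 1. For all $f,g\in\mathcal F^N_I(\mathbb H)$ the integral defining $\langle f,g\rangle_I$ converges absolutely, and $\mathcal F^N_I(\mathbb H)$, with pointwise addition and right multiplication by quaternions, is a right quaternionic Hilbert space: it is a right $\mathbb H$-vector space, $\langle\cdot,\cdot\rangle_I$ is additive in the first argument with $\langle fa,g\rangle_I=\langle f,g\rangle_I\,a$ for $a\in\mathbb H$, is Hermitian and positive definite, and the space is complete for $\|\cdot\|_I$. 2. For all $f\in\mathcal F^N_I(\mathbb H)$ and all $q\in\mathbb H$ (not only $q\in\mathbb C_I$), $$|f(q)|\le\sqrt N\,e^{|q|^2/2}\,\|f\|_I .$$ -/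

import Mathlib

open scoped Quaternion Topology

noncomputable section

namespace SliceFock

/-- The sphere of imaginary units of the quaternions. -/
def imagUnits : Set ℍ[ℝ] := {I | I ^ 2 = -1}

/-- The point `x + I y` of the slice `ℂ_I = ℝ + I ℝ`. -/
def slicePt (I : ℍ[ℝ]) (x y : ℝ) : ℍ[ℝ] := (x : ℍ[ℝ]) + I * (y : ℍ[ℝ])

/-- Slice functions on the whole of `ℍ`: `f (x + I y) = α (x, y) + I β (x, y)` for all imaginary
units `I`, with `α` even and `β` odd in `y`, both independent of `I`. -/
def IsSliceFunction (f : ℍ[ℝ] → ℍ[ℝ]) : Prop :=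
  ∃ α β : ℝ → ℝ → ℍ[ℝ],
    (∀ x y, α x (-y) = α x y) ∧ (∀ x y, β x (-y) = -β x y) ∧
    ∀ I ∈ imagUnits, ∀ x y : ℝ, f (slicePt I x y) = α x y + I * β x y

/-- `f` is `N` times (real, Fréchet) differentiable on `ℍ`: the derivatives of all
orders `m < N` exist and are differentiable. -/
def NTimesDifferentiable (N : ℕ) (f : ℍ[ℝ] → ℍ[ℝ]) : Prop :=
  ∀ m < N, Differentiable ℝ (iteratedFDeriv ℝ m f)

/-- The left Cauchy-Riemann operator `(1/2) (∂/∂x + I ∂/∂y)`, acting on functions of the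
real coordinates `(x, y)` of the slice `ℂ_I`. -/
def dbar (I : ℍ[ℝ]) (F : ℝ → ℝ → ℍ[ℝ]) : ℝ → ℝ → ℍ[ℝ] := fun x y =>
  (1 / 2 : ℝ) • (deriv (fun s : ℝ => F s y) x + I * deriv (fun t : ℝ => F x t) y)

/-- (Left) slice polyanalytic functions of order `N` on `ℍ`. -/
def IsSlicePolyanalytic (N : ℕ) (f : ℍ[ℝ] → ℍ[ℝ]) : Prop :=
  IsSliceFunction f ∧ NTimesDifferentiable N f ∧
    ∀ I ∈ imagUnits, ∀ x y : ℝ, (dbar I)^[N] (fun s t => f (slicePt I s t)) x y = 0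

/-- The slice polyanalytic Fock space (as a set of functions on `ℍ`): slice polyanalytic
functions of order `N` whose restriction to `ℂ_I` is square integrable against
`exp (-|p|^2) dx dy`. -/
def fockSpace (N : ℕ) (I : ℍ[ℝ]) : Set (ℍ[ℝ] → ℍ[ℝ]) :=
  {f | IsSlicePolyanalytic N f ∧
    MeasureTheory.Integrable (fun p : ℝ × ℝ =>
      ‖f (slicePt I p.1 p.2)‖ ^ 2 * Real.exp (-‖slicePt I p.1 p.2‖ ^ 2)) MeasureTheory.volume}

/-- The integrand `conj (g p) * f p * exp (-|p|^2)` of the inner product, at `p = x + I y`. -/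
def fockIntegrand (I : ℍ[ℝ]) (f g : ℍ[ℝ] → ℍ[ℝ]) (p : ℝ × ℝ) : ℍ[ℝ] :=
  Real.exp (-‖slicePt I p.1 p.2‖ ^ 2) • (star (g (slicePt I p.1 p.2)) * f (slicePt I p.1 p.2))

/-- The inner product `⟨f, g⟩ = ∫_{ℂ_I} conj (g p) f p exp (-|p|^2) dx dy`. -/
def fockInner (I : ℍ[ℝ]) (f g : ℍ[ℝ] → ℍ[ℝ]) : ℍ[ℝ] :=
  ∫ p : ℝ × ℝ, fockIntegrand I f g p

/-- The norm induced by a quaternion valued inner product. -/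
def ipNorm {V : Type*} (ip : V → V → ℍ[ℝ]) (v : V) : ℝ := Real.sqrt (ip v v).re

/-- A right quaternionic Hilbert space: a right `ℍ`-vector space (a module over `ℍᵐᵒᵖ`) with a
positive definite Hermitian `ℍ`-valued inner product, right linear in the first
argument, that is complete for the induced norm. -/
structure IsRightHilbertSpace (V : Type*) [AddCommGroup V] [Module ℍ[ℝ]ᵐᵒᵖ V]
    (ip : V → V → ℍ[ℝ]) : Prop where
  add_left : ∀ u v w, ip (u + v) w = ip u w + ip v w
  smul_left : ∀ (a : ℍ[ℝ]) (u w : V), ip (MulOpposite.op a • u) w = ip u w * a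
  conj_symm : ∀ u v, star (ip u v) = ip v u
  nonneg : ∀ u, 0 ≤ (ip u u).re
  definite : ∀ u, ip u u = 0 → u = 0
  complete : ∀ u : ℕ → V,
    (∀ ε : ℝ, 0 < ε → ∃ M : ℕ, ∀ m ≥ M, ∀ n ≥ M, ipNorm ip (u m - u n) < ε) →
    ∃ v : V, Filter.Tendsto (fun n => ipNorm ip (u n - v)) Filter.atTop (𝓝 0)

end SliceFock

end

/-!
The proof identifies the slice polyanalytic functions of order `N` with the sums
`f q = ∑_{k < N} (star q) ^ k * h_k q` of everywhere convergent quaternionic power series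
`h_k q = ∑ n, q ^ n * a k n` (`isSlicePolyanalytic_iff`). On a slice, regarded as the complex plane
acting on the quaternions by left multiplication, the equation `dbar ^ N f = 0` yields
`F z = ∑_{k < N} conj z ^ k • h_k z` with entire `h_k`
(`isPolyentire_of_wirtinger_iterate_eq_zero`). The Taylor coefficients of the `h_k` define a smooth
function on all quaternions, and the representation formula for slice functions
(`IsSliceFunction.eq_of_slice`) shows that it is `f`.

The pointwise bound is proved first on the slice, in the sharper form
`|F z| ^ 2 ≤ (N / π) exp (|z| ^ 2) ‖F‖ ^ 2` (`IsPolyentire.norm_sq_le`). A Weyl translation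
moves `z` to the origin. The averages of `F` over circles about the origin form a polynomial
of degree less than `N` in the squared radius with constant term `F 0`, and the value
at `0` of such a polynomial is reproduced by integration against a Laguerre polynomial of
squared norm `N` (`norm_sq_le_integral_radialWeight`). Off the slice, the representation formula
gives `|f q| ^ 2 ≤ |f z| ^ 2 + |f (conj z)| ^ 2`, and the factor `2` is absorbed since `2 ≤ π`.

For completeness, a Cauchy sequence is by the pointwise bound uniformly Cauchy on discs of the
slice. The maximum principle on circles of `N` different radii bounds the components `h_k` by `F`
(`exists_norm_component_le`), so that the pointwise limit is polyanalytic again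
(`IsPolyentire.exists_tendsto`); it extends to the quaternions, and Fatou's lemma gives
convergence in norm.
-/

noncomputable section

namespace SliceFock

open scoped ComplexConjugate
open Finset

/-! ### Polyanalytic functions on the complex plane -/

section Polyanalytic

variable {E : Type*} [NormedAddCommGroup E] [NormedSpace ℂ E]

/-- Entire polyanalytic functions of order `N` with values in a complex normed space, encoded
through their decomposition `F z = ∑_{k < N} conj z ^ k • h k z` with entire components. -/
def IsPolyentire (N : ℕ) (F : ℂ → E) : Prop :=
  ∃ h : ℕ → ℂ → E, (∀ k, Differentiable ℂ (h k)) ∧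
    ∀ z, F z = ∑ k ∈ range N, conj z ^ k • h k z

/-- The Wirtinger derivative `∂F/∂(conj z) = (1/2) (∂F/∂x + i ∂F/∂y)`. -/
def wirtinger (F : ℂ → E) (z : ℂ) : E :=
  (1 / 2 : ℝ) • (fderiv ℝ F z 1 + Complex.I • fderiv ℝ F z Complex.I)

namespace IsPolyentire

lemma zero (N : ℕ) : IsPolyentire N (fun _ => (0 : E)) :=
  ⟨fun _ _ => 0, fun _ => differentiable_const _, fun z => by simp⟩

lemma add {N : ℕ} {F G : ℂ → E} (hF : IsPolyentire N F) (hG : IsPolyentire N G) :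
    IsPolyentire N (fun z => F z + G z) := by
  obtain ⟨h, hd, hF⟩ := hF
  obtain ⟨k, kd, hG⟩ := hG
  exact ⟨fun n z => h n z + k n z, fun n => (hd n).add (kd n), fun z => by
    simp [hF, hG, smul_add, sum_add_distrib]⟩

lemma sum {ι : Type*} {N : ℕ} (s : Finset ι) {F : ι → ℂ → E}
    (hF : ∀ i ∈ s, IsPolyentire N (F i)) : IsPolyentire N (fun z => ∑ i ∈ s, F i z) := by
  classical
  induction s using Finset.induction_on with
  | empty => simpa using zero N
  | insert a s ha ih =>
    simp only [sum_insert ha]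
    exact (hF a (by simp)).add (ih fun i hi => hF i (by simp [hi]))

lemma conj_pow_smul {N k : ℕ} (hk : k < N) {h : ℂ → E} (hh : Differentiable ℂ h) :
    IsPolyentire N (fun z => conj z ^ k • h z) := by
  refine ⟨fun m => if m = k then h else fun _ => 0, fun m => ?_, fun z => ?_⟩
  · dsimp only
    split_ifs
    · exact hh
    · exact differentiable_const _
  · rw [sum_eq_single k]
    · simp
    · intro b _ hb
      simp [hb]
    · intro hk'
      exact absurd (mem_range.2 hk) hk'

lemma entire_smul {N : ℕ} {F : ℂ → E} (hF : IsPolyentire N F) {g : ℂ → ℂ}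
    (hg : Differentiable ℂ g) : IsPolyentire N (fun z => g z • F z) := by
  obtain ⟨h, hd, hF⟩ := hF
  refine ⟨fun k z => g z • h k z, fun k => hg.smul (hd k), fun z => ?_⟩
  simp only [hF, smul_sum]
  exact sum_congr rfl fun k _ => smul_comm _ _ _

lemma comp_add_const {N : ℕ} {F : ℂ → E} (hF : IsPolyentire N F) (a : ℂ) :
    IsPolyentire N (fun z => F (z + a)) := by
  obtain ⟨h, hd, hF⟩ := hF
  simp only [hF, map_add, add_pow, sum_smul]
  refine sum _ fun k hk => sum _ fun m hm => ?_
  have hda : Differentiable ℂ fun z : ℂ => h k (z + a) :=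
    (hd k).comp (differentiable_id.add_const a)
  have := conj_pow_smul (N := N) (k := m) (by simp at hk hm; omega)
    (hda.const_smul (conj a ^ (k - m) * (k.choose m : ℂ)))
  simpa only [smul_smul, mul_assoc, Pi.smul_apply] using this

lemma contDiff [CompleteSpace E] {N : ℕ} {F : ℂ → E} (hF : IsPolyentire N F) :
    ContDiff ℝ 1 F := by
  obtain ⟨h, hd, hF⟩ := hF
  rw [funext hF]
  refine ContDiff.sum fun k _ => ?_
  have h1 : ContDiff ℝ 1 (h k) := ((hd k).contDiff (n := 1)).restrict_scalars ℝ
  have h2 : ContDiff ℝ 1 (fun z : ℂ => conj z ^ k) :=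
    (Complex.conjCLE.contDiff (n := 1)).pow k
  exact h2.smul h1

lemma continuous [CompleteSpace E] {N : ℕ} {F : ℂ → E} (hF : IsPolyentire N F) :
    Continuous F := hF.contDiff.continuous

end IsPolyentire

lemma wirtinger_conj_pow_smul (k : ℕ) {h : ℂ → E} (hh : Differentiable ℂ h) (z : ℂ) :
    wirtinger (fun z => conj z ^ k • h z) z = (k : ℂ) • conj z ^ (k - 1) • h z := by
  have h1 : HasFDerivAt h ((fderiv ℂ h z).restrictScalars ℝ) z :=
    (hh z).hasFDerivAt.restrictScalars ℝ
  have h2 : HasFDerivAt (fun z : ℂ => conj z ^ k) _ z :=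
    (Complex.conjCLE.hasFDerivAt (x := z)).pow k
  have h3 := (h2.smul h1).fderiv
  have h4 : fderiv ℂ h z Complex.I = Complex.I • fderiv ℂ h z 1 := by
    rw [← map_smul]; simp
  have h5 : wirtinger (fun z => conj z ^ k • h z) z = (1 / 2 : ℝ) •
      (fderiv ℝ ((fun z : ℂ => conj z ^ k) • h) z 1 +
        Complex.I • fderiv ℝ ((fun z : ℂ => conj z ^ k) • h) z Complex.I) := rfl
  have h6 : ∀ x : E, (1 / 2 : ℝ) • x = (1 / 2 : ℂ) • x := fun x => by
    rw [← Complex.coe_smul]; simp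
  rw [h5, h3, h6]
  simp only [add_apply, smul_apply, ContinuousLinearMap.smulRight_apply,
    ContinuousLinearMap.coe_restrictScalars', h4, ContinuousLinearEquiv.coe_coe,
    Complex.conjCLE_apply, map_one, Complex.conj_I, smul_eq_mul, nsmul_eq_mul]
  match_scalars
  · linear_combination (1 / 2 : ℂ) * conj z ^ k * Complex.I_sq
  · linear_combination (-1 / 2 : ℂ) * k * conj z ^ (k - 1) * Complex.I_sq

lemma wirtinger_eq_zero_iff {F : ℂ → E} (hF : Differentiable ℝ F) :
    (∀ z, wirtinger F z = 0) ↔ Differentiable ℂ F := by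
  have key : ∀ z, wirtinger F z = 0 ↔
      fderiv ℝ F z Complex.I = Complex.I • fderiv ℝ F z 1 := fun z => by
    have h1 : fderiv ℝ F z 1 + Complex.I • fderiv ℝ F z Complex.I =
        -Complex.I • (Complex.I • fderiv ℝ F z 1 - fderiv ℝ F z Complex.I) := by
      simp [smul_sub, smul_smul]
    rw [wirtinger, h1, smul_eq_zero_iff_right (by norm_num), neg_smul, neg_eq_zero,
      smul_eq_zero_iff_right Complex.I_ne_zero, sub_eq_zero, eq_comm]
  simp only [key]
  exact ⟨fun h z => differentiableAt_complex_iff_differentiableAt_real.2 ⟨hF z, h z⟩,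
    fun h z => (differentiableAt_complex_iff_differentiableAt_real.1 (h z)).2⟩

lemma wirtinger_add {F G : ℂ → E} (hF : Differentiable ℝ F) (hG : Differentiable ℝ G) (z : ℂ) :
    wirtinger (fun z => F z + G z) z = wirtinger F z + wirtinger G z := by
  simp only [wirtinger, fderiv_fun_add (hF z) (hG z), add_apply, smul_add]
  abel

lemma wirtinger_sub {F G : ℂ → E} (hF : Differentiable ℝ F) (hG : Differentiable ℝ G) (z : ℂ) :
    wirtinger (fun z => F z - G z) z = wirtinger F z - wirtinger G z := by
  simp only [wirtinger, fderiv_fun_sub (hF z) (hG z), sub_apply, smul_add,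
    smul_sub]
  abel

lemma wirtinger_sum_conj_pow_smul [CompleteSpace E] (N : ℕ) {h : ℕ → ℂ → E}
    (hh : ∀ k, Differentiable ℂ (h k)) (z : ℂ) :
    wirtinger (fun z => ∑ k ∈ range N, conj z ^ k • h k z) z =
      ∑ k ∈ range N, (k : ℂ) • conj z ^ (k - 1) • h k z := by
  induction N with
  | zero => simp [wirtinger]
  | succ N ih =>
    simp only [sum_range_succ]
    have h1 : IsPolyentire N (fun z => ∑ k ∈ range N, conj z ^ k • h k z) :=
      ⟨h, hh, fun _ => rfl⟩
    have h2 : IsPolyentire (N + 1) (fun z => conj z ^ N • h N z) :=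
      .conj_pow_smul (by simp) (hh N)
    rw [wirtinger_add (h1.contDiff.differentiable (by simp))
      (h2.contDiff.differentiable (by simp)), ih, wirtinger_conj_pow_smul N (hh N)]

lemma IsPolyentire.wirtinger [CompleteSpace E] {N : ℕ} {F : ℂ → E} (hF : IsPolyentire (N + 1) F) :
    IsPolyentire N (wirtinger F) := by
  obtain ⟨h, hd, hF⟩ := hF
  refine ⟨fun k z => ((k + 1 : ℕ) : ℂ) • h (k + 1) z, fun k => (hd _).const_smul _, fun z => ?_⟩
  rw [funext hF, wirtinger_sum_conj_pow_smul _ hd, sum_range_succ']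
  simp only [Nat.cast_zero, zero_smul, add_zero, Nat.add_sub_cancel]
  exact sum_congr rfl fun k _ => smul_comm _ _ _

lemma IsPolyentire.wirtinger_iterate [CompleteSpace E] {N : ℕ} {F : ℂ → E}
    (hF : IsPolyentire N F) : ∀ m ≤ N, IsPolyentire (N - m) (SliceFock.wirtinger^[m] F) := by
  intro m hm
  induction m with
  | zero => simpa using hF
  | succ m ih =>
    rw [Function.iterate_succ_apply']
    have := ih (by omega)
    rw [show N - m = N - (m + 1) + 1 by omega] at this
    exact this.wirtinger

/-- A function annihilated by the `N`-th power of the Cauchy-Riemann operator is polyanalytic: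
its first Wirtinger derivative is a sum of terms `conj z ^ k • h k z`, each of which has the
primitive `conj z ^ (k + 1) • h k z / (k + 1)`, and the difference of `F` and the sum of these
primitives satisfies the Cauchy-Riemann equation. -/
theorem isPolyentire_of_wirtinger_iterate_eq_zero [CompleteSpace E] (N : ℕ) {F : ℂ → E}
    (hd : ∀ m < N, Differentiable ℝ (wirtinger^[m] F)) (h0 : ∀ z, wirtinger^[N] F z = 0) :
    IsPolyentire N F := by
  induction N generalizing F with
  | zero => exact ⟨fun _ _ => 0, fun _ => differentiable_const _, fun z => by simpa using h0 z⟩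
  | succ N ih =>
    obtain ⟨h, hh, hF⟩ := ih (F := wirtinger F)
      (fun m hm => by
        rw [← Function.iterate_succ_apply]
        exact hd (m + 1) (by omega))
      (fun z => by
        rw [← Function.iterate_succ_apply]
        exact h0 z)
    let H : ℕ → ℂ → E := fun k => if k = 0 then fun _ => 0 else fun z => (k : ℂ)⁻¹ • h (k - 1) z
    have hH : ∀ k, Differentiable ℂ (H k) := fun k => by
      rcases k with _ | k
      · simp [H]
      · simp only [H, Nat.succ_ne_zero, if_false, Nat.add_sub_cancel]
        exact (hh k).const_smul (((k + 1 : ℕ) : ℂ)⁻¹)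
    have hG : IsPolyentire (N + 1) (fun z => ∑ k ∈ range (N + 1), conj z ^ k • H k z) :=
      ⟨H, hH, fun _ => rfl⟩
    have hGd := hG.contDiff.differentiable (by simp)
    have hFd : Differentiable ℝ F := hd 0 (by omega)
    have hE : Differentiable ℂ
        (fun z => F z - ∑ k ∈ range (N + 1), conj z ^ k • H k z) := by
      refine (wirtinger_eq_zero_iff (hFd.sub hGd)).1 fun z => ?_
      change wirtinger (fun z => F z - ∑ k ∈ range (N + 1), conj z ^ k • H k z) z = 0
      rw [wirtinger_sub hFd hGd, wirtinger_sum_conj_pow_smul _ hH, hF, sum_range_succ', sub_eq_zero]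
      simp only [Nat.cast_zero, zero_smul, add_zero, Nat.add_sub_cancel]
      refine sum_congr rfl fun k _ => ?_
      have hk : ((k + 1 : ℕ) : ℂ) ≠ 0 := Nat.cast_ne_zero.2 (Nat.succ_ne_zero k)
      simp only [H, Nat.succ_ne_zero, if_false, Nat.add_sub_cancel]
      rw [smul_comm (conj z ^ k), smul_inv_smul₀ hk]
    have := (IsPolyentire.conj_pow_smul (N := N + 1) (k := 0) (by omega) hE).add hG
    simpa using this

end Polyanalytic

/-! ### Circle averages of polyanalytic functions -/

section CircleAverage

open Real (circleAverage)

variable {E : Type*} [NormedAddCommGroup E] [NormedSpace ℂ E] [CompleteSpace E]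

lemma circleAverage_entire {h : ℂ → E} (hh : Differentiable ℂ h) (r : ℝ) :
    circleAverage h 0 r = h 0 :=
  hh.diffContOnCl.circleAverage

lemma circleAverage_conj_pow_smul_const (k : ℕ) (a : E) (r : ℝ) :
    circleAverage (fun z => conj z ^ (k + 1) • a) 0 r = 0 := by
  let L : ℂ →L[ℝ] E := (Complex.conjCLE : ℂ →L[ℝ] ℂ).smulRight a
  have h1 : (fun z => conj z ^ (k + 1) • a) = L ∘ fun z => z ^ (k + 1) := by
    ext z
    simp [L]
  have h2 : Continuous fun z : ℂ => z ^ (k + 1) := by fun_prop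
  rw [h1, L.circleAverage_comp_comm h2.continuousOn.circleIntegrable',
    circleAverage_entire (by fun_prop)]
  simp

/-- On the circle of radius `r` one has `conj z * z = r ^ 2`; splitting off the value at the origin
and dividing the remainder by `z` lowers the power of `conj z`. -/
lemma exists_circleAverage_conj_pow_smul (k : ℕ) {h : ℂ → E} (hh : Differentiable ℂ h) :
    ∃ c : E, (k = 0 → c = h 0) ∧
      ∀ r : ℝ, circleAverage (fun z => conj z ^ k • h z) 0 r = r ^ (2 * k) • c := by
  induction k generalizing h with
  | zero => exact ⟨h 0, fun _ => rfl, fun r => by simpa using circleAverage_entire hh r⟩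
  | succ k ih =>
    have hg : Differentiable ℂ (dslope h 0) := by
      rw [← differentiableOn_univ,
        Complex.differentiableOn_dslope Filter.univ_mem, differentiableOn_univ]
      exact hh
    obtain ⟨c, -, hc⟩ := ih hg
    refine ⟨c, by simp, fun r => ?_⟩
    have h1 : Set.EqOn (fun z => conj z ^ (k + 1) • h z)
        (fun z => conj z ^ (k + 1) • h 0 + r ^ 2 • conj z ^ k • dslope h 0 z)
        (Metric.sphere 0 |r|) := by
      intro z hz
      have hz' : conj z * z = ((r ^ 2 : ℝ) : ℂ) := by
        rw [← Complex.normSq_eq_conj_mul_self, Complex.normSq_eq_norm_sq]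
        rw [mem_sphere_zero_iff_norm.1 hz, sq_abs]
      have h2 : h z = h 0 + z • dslope h 0 z := by
        have := sub_smul_dslope h 0 z
        rw [sub_zero] at this
        rw [this]; abel
      dsimp only
      rw [← Complex.coe_smul, ← hz']
      conv_lhs => rw [h2]
      rw [smul_add, smul_smul, smul_smul]
      congr 2
      ring
    have c1 : Continuous fun z : ℂ => conj z ^ (k + 1) • h 0 := by fun_prop
    have c2 : Continuous fun z : ℂ => conj z ^ k • dslope h 0 z := by
      have := hg.continuous
      fun_prop
    have c3 : Continuous fun z : ℂ => r ^ 2 • conj z ^ k • dslope h 0 z := c2.const_smul _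
    rw [Real.circleAverage_congr_sphere h1, Real.circleAverage_fun_add
      c1.continuousOn.circleIntegrable' c3.continuousOn.circleIntegrable',
      circleAverage_conj_pow_smul_const, zero_add, Real.circleAverage_fun_smul, hc r, smul_smul]
    congr 1
    ring

/-- The circle averages about the origin of a polyanalytic function of order `N` form a polynomial
of degree less than `N` in the square of the radius. -/
lemma IsPolyentire.exists_circleAverage_eq {N : ℕ} (hN : 1 ≤ N) {F : ℂ → E}
    (hF : IsPolyentire N F) : ∃ c : ℕ → E, c 0 = F 0 ∧
      ∀ r : ℝ, circleAverage F 0 r = ∑ m ∈ range N, r ^ (2 * m) • c m := by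
  obtain ⟨h, hd, hF⟩ := hF
  choose c hc0 hc using fun k => exists_circleAverage_conj_pow_smul k (hd k)
  refine ⟨c, ?_, fun r => ?_⟩
  · rw [hc0 0 rfl, hF 0, sum_eq_single_of_mem 0 (mem_range.2 hN)]
    · simp
    · intro b _ hb
      simp [hb]
  · rw [funext hF, Real.circleAverage_fun_sum]
    · exact sum_congr rfl fun k _ => hc k r
    · intro k _
      have : Continuous fun z : ℂ => conj z ^ k • h k z := by
        have := (hd k).continuous
        fun_prop
      exact this.continuousOn.circleIntegrable'

omit [CompleteSpace E] in
lemma two_pi_mul_norm_circleAverage_sq_le {G : ℂ → E} (hG : Continuous G) (r : ℝ) :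
    2 * Real.pi * ‖circleAverage G 0 r‖ ^ 2 ≤
      ∫ θ in -Real.pi..Real.pi, ‖G (circleMap 0 r θ)‖ ^ 2 := by
  have hc : Continuous fun θ => G (circleMap 0 r θ) := by fun_prop
  have h1 : circleAverage G 0 r =
      (2 * Real.pi)⁻¹ • ∫ θ in -Real.pi..Real.pi, G (circleMap 0 r θ) := by
    rw [Real.circleAverage_eq_integral_add (-Real.pi),
      intervalIntegral.integral_comp_add_right (fun θ => G (circleMap 0 r θ))]
    congr 2 <;> ring
  set m := ‖circleAverage G 0 r‖
  have hpi := Real.pi_pos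
  have h2 : 2 * Real.pi * m ≤ ∫ θ in -Real.pi..Real.pi, ‖G (circleMap 0 r θ)‖ := by
    have : m = (2 * Real.pi)⁻¹ * ‖∫ θ in -Real.pi..Real.pi, G (circleMap 0 r θ)‖ := by
      simp only [m, h1, norm_smul, norm_inv, Real.norm_eq_abs, abs_of_pos Real.two_pi_pos]
    rw [this, mul_inv_cancel_left₀ Real.two_pi_pos.ne']
    exact intervalIntegral.norm_integral_le_integral_norm (by linarith)
  have h3 : ∫ θ in -Real.pi..Real.pi, (2 * m * ‖G (circleMap 0 r θ)‖ - m ^ 2) ≤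
      ∫ θ in -Real.pi..Real.pi, ‖G (circleMap 0 r θ)‖ ^ 2 := by
    refine intervalIntegral.integral_mono_on (by linarith)
      (Continuous.intervalIntegrable (by fun_prop) _ _)
      (Continuous.intervalIntegrable (by fun_prop) _ _) fun θ _ => ?_
    nlinarith [sq_nonneg (‖G (circleMap 0 r θ)‖ - m)]
  rw [intervalIntegral.integral_sub (Continuous.intervalIntegrable (by fun_prop) _ _)
    (Continuous.intervalIntegrable (by fun_prop) _ _), intervalIntegral.integral_const_mul,
    intervalIntegral.integral_const, smul_eq_mul] at h3
  have h4 : 2 * m * (2 * Real.pi * m) ≤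
      2 * m * ∫ θ in -Real.pi..Real.pi, ‖G (circleMap 0 r θ)‖ :=
    mul_le_mul_of_nonneg_left h2 (by positivity)
  nlinarith

end CircleAverage

/-! ### The radial reproducing polynomial -/

section Radial

open MeasureTheory Set

/-- The coefficients of the polynomial `∑ i < N, (-1) ^ i * C(N, i + 1) / i! * t ^ i`, a generalized
Laguerre polynomial, which reproduces the value at `0` of polynomials of degree less than `N`
for the weight `exp (-t)` on the half line. -/
def laguerreCoeff (N i : ℕ) : ℝ := (-1) ^ i * (N.choose (i + 1)) / (i.factorial : ℝ)

/-- This is the vanishing of the `N`-th difference of a polynomial of degree `m < N` with zeros at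
`0, -1, …, 1 - m`. -/
lemma sum_laguerreCoeff_mul_factorial {N m : ℕ} (hm : m < N) :
    ∑ i ∈ range N, laguerreCoeff N i * ((i + m).factorial : ℝ) = if m = 0 then 1 else 0 := by
  have h1 := congrFun (Polynomial.fwdDiff_iter_eq_zero_of_degree_lt (R := ℝ)
    (P := ascPochhammer ℝ m) (n := N) (by rwa [ascPochhammer_natDegree])) 0
  rw [fwdDiff_iter_eq_sum_shift, Finset.sum_range_succ'] at h1
  have h2 : ∀ i ∈ range N, laguerreCoeff N i * ((i + m).factorial : ℝ) =
      (-1) ^ i * N.choose (i + 1) * (ascPochhammer ℝ m).eval ((i + 1 : ℕ) : ℝ) := by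
    intro i _
    rw [← ascPochhammer_eval_cast, ascPochhammer_nat_eq_ascFactorial, laguerreCoeff,
      ← Nat.factorial_mul_ascFactorial]
    have : (i.factorial : ℝ) ≠ 0 := by positivity
    push_cast
    field_simp
  rw [Finset.sum_congr rfl h2]
  have h3 : ∀ i ∈ range N, ((-1 : ℤ) ^ (N - (i + 1)) * (N.choose (i + 1) : ℤ)) •
      (ascPochhammer ℝ m).eval (0 + (i + 1) • (1 : ℝ)) = -((-1 : ℝ) ^ N) *
        ((-1) ^ i * N.choose (i + 1) * (ascPochhammer ℝ m).eval ((i + 1 : ℕ) : ℝ)) := by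
    intro i hi
    have h4 : (-1 : ℝ) ^ N = (-1) ^ (N - (i + 1)) * (-1) ^ (i + 1) := by
      rw [← pow_add, Nat.sub_add_cancel (Finset.mem_range.1 hi)]
    have h5 : (-1 : ℝ) ^ (i + 1) * (-1) ^ i = -1 := by
      rw [← pow_add, show i + 1 + i = 2 * i + 1 by ring]
      simp [pow_succ, pow_mul]
    rw [zero_add, nsmul_one, zsmul_eq_mul, h4]
    push_cast
    linear_combination ((-1 : ℝ) ^ (N - (i + 1)) * N.choose (i + 1) *
      (ascPochhammer ℝ m).eval ((i : ℝ) + 1)) * h5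
  have h6 : (ascPochhammer ℝ m).eval 0 = if m = 0 then 1 else 0 := ascPochhammer_eval_zero ℝ
  rw [Finset.sum_congr rfl h3, ← Finset.mul_sum] at h1
  simp only [Nat.sub_zero, Nat.choose_zero_right, Nat.cast_one, mul_one, zero_smul, add_zero, h6,
    Pi.zero_apply, zsmul_eq_mul, Int.cast_pow, Int.cast_neg, Int.cast_one] at h1
  have h7 : (-1 : ℝ) ^ N ≠ 0 := by positivity
  exact mul_left_cancel₀ h7 (by linarith)

lemma laguerreCoeff_zero (N : ℕ) : laguerreCoeff N 0 = N := by simp [laguerreCoeff]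

/-- The density of the radial part of the Gaussian measure. -/
def radialWeight (r : ℝ) : ℝ := 2 * r * Real.exp (-r ^ 2)

lemma radialWeight_mul_pow_eq {m : ℕ} {r : ℝ} (hr : r ∈ Ioi (0 : ℝ)) :
    radialWeight r * r ^ (2 * m) =
      2 * (r ^ (2 * (m : ℝ) + 1) * Real.exp (-r ^ (2 : ℝ))) := by
  have h1 : r ^ (2 * (m : ℝ) + 1) = r ^ (2 * m) * r := by
    rw [Real.rpow_add_one (ne_of_gt hr)]
    congr 1
    exact_mod_cast Real.rpow_natCast r (2 * m)
  rw [radialWeight, h1, Real.rpow_two]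
  ring

lemma integrableOn_radialWeight_mul_pow (m : ℕ) :
    IntegrableOn (fun r => radialWeight r * r ^ (2 * m)) (Ioi 0) := by
  refine IntegrableOn.congr_fun ((integrableOn_rpow_mul_exp_neg_rpow (p := 2)
    (s := 2 * m + 1) ?_ (by norm_num)).const_mul 2)
    (fun r hr => (radialWeight_mul_pow_eq hr).symm) measurableSet_Ioi
  have : (0 : ℝ) ≤ m := Nat.cast_nonneg m
  linarith

lemma integral_radialWeight_mul_pow (m : ℕ) :
    ∫ r in Ioi (0 : ℝ), radialWeight r * r ^ (2 * m) = m.factorial := by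
  have h := integral_rpow_mul_exp_neg_rpow (p := 2) (q := 2 * m + 1) (by norm_num)
    (by have : (0 : ℝ) ≤ m := Nat.cast_nonneg m
        linarith)
  rw [setIntegral_congr_fun measurableSet_Ioi (fun r hr => radialWeight_mul_pow_eq hr),
    integral_const_mul, h, show (2 * (m : ℝ) + 1 + 1) / 2 = m + 1 by ring,
    Real.Gamma_nat_eq_factorial]
  ring

/-- The radial reproducing polynomial as a function of the radius. -/
def laguerreKernel (N : ℕ) (r : ℝ) : ℝ := ∑ i ∈ range N, r ^ (2 * i) * laguerreCoeff N i

lemma radialWeight_mul_laguerreKernel_smul {E : Type*} [NormedAddCommGroup E] [NormedSpace ℝ E]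
    (N : ℕ) (c : ℕ → E) (r : ℝ) :
    (radialWeight r * laguerreKernel N r) • ∑ m ∈ range N, r ^ (2 * m) • c m =
      ∑ m ∈ range N, ∑ i ∈ range N,
        (radialWeight r * r ^ (2 * (i + m))) • laguerreCoeff N i • c m := by
  rw [smul_sum]
  refine Finset.sum_congr rfl fun m _ => ?_
  rw [laguerreKernel, mul_sum, sum_smul]
  refine Finset.sum_congr rfl fun i _ => ?_
  rw [smul_smul, smul_smul]
  congr 1
  ring

lemma integrableOn_laguerreKernel_smul {E : Type*} [NormedAddCommGroup E] [NormedSpace ℝ E]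
    (N : ℕ) (c : ℕ → E) :
    IntegrableOn (fun r => (radialWeight r * laguerreKernel N r) •
      ∑ m ∈ range N, r ^ (2 * m) • c m) (Ioi 0) := by
  simp only [radialWeight_mul_laguerreKernel_smul]
  exact integrable_finsetSum _ fun m _ => integrable_finsetSum _ fun i _ =>
    (integrableOn_radialWeight_mul_pow (i + m)).smul_const _

/-- The reproducing property of the kernel: the radial integral returns the constant term. -/
lemma integral_laguerreKernel_smul {E : Type*} [NormedAddCommGroup E] [NormedSpace ℝ E]
    [CompleteSpace E] {N : ℕ} (hN : 1 ≤ N) (c : ℕ → E) :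
    ∫ r in Ioi (0 : ℝ), (radialWeight r * laguerreKernel N r) •
      ∑ m ∈ range N, r ^ (2 * m) • c m = c 0 := by
  simp only [radialWeight_mul_laguerreKernel_smul]
  have hi : ∀ m i, Integrable (fun r => (radialWeight r * r ^ (2 * (i + m))) •
      laguerreCoeff N i • c m) (volume.restrict (Ioi 0)) := fun m i =>
    (integrableOn_radialWeight_mul_pow (i + m)).smul_const _
  rw [integral_finsetSum _ fun m _ => integrable_finsetSum _ fun i _ => hi m i]
  have h1 : ∀ m ∈ range N, ∫ r in Ioi (0 : ℝ), ∑ i ∈ range N,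
      (radialWeight r * r ^ (2 * (i + m))) • laguerreCoeff N i • c m =
        (if m = 0 then (1 : ℝ) else 0) • c m := by
    intro m hm
    rw [integral_finsetSum _ fun i _ => hi m i,
      ← sum_laguerreCoeff_mul_factorial (Finset.mem_range.1 hm), sum_smul]
    refine Finset.sum_congr rfl fun i _ => ?_
    rw [integral_smul_const, integral_radialWeight_mul_pow, smul_smul, mul_comm]
  rw [Finset.sum_congr rfl h1, Finset.sum_eq_single_of_mem 0 (Finset.mem_range.2 hN)]
  · simp
  · intro b _ hb
    simp [hb]

/-- The Cauchy-Schwarz inequality against the reproducing polynomial, whose weighted square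
integral is its value `N` at the origin. -/
lemma norm_sq_le_integral_radialWeight {E : Type*} [NormedAddCommGroup E] [NormedSpace ℝ E]
    [CompleteSpace E] {N : ℕ} (hN : 1 ≤ N) (c : ℕ → E)
    (hi : IntegrableOn (fun r => radialWeight r * ‖∑ m ∈ range N, r ^ (2 * m) • c m‖ ^ 2)
      (Ioi 0)) :
    ‖c 0‖ ^ 2 ≤
      N * ∫ r in Ioi (0 : ℝ), radialWeight r * ‖∑ m ∈ range N, r ^ (2 * m) • c m‖ ^ 2 := by
  rcases eq_or_ne (c 0) 0 with h0 | h0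
  · rw [h0, norm_zero, zero_pow two_ne_zero]
    refine mul_nonneg (Nat.cast_nonneg N) (setIntegral_nonneg measurableSet_Ioi fun r hr => ?_)
    have : (0 : ℝ) < r := hr
    simp only [radialWeight]
    positivity
  set A := ∫ r in Ioi (0 : ℝ), radialWeight r * ‖∑ m ∈ range N, r ^ (2 * m) • c m‖ ^ 2 with hA
  have hN' : (0 : ℝ) < N := by exact_mod_cast hN
  have hc : 0 < ‖c 0‖ := norm_pos_iff.2 h0
  have hK := integral_laguerreKernel_smul hN (laguerreCoeff N)
  have hKi := integrableOn_laguerreKernel_smul N (laguerreCoeff N)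
  simp only [smul_eq_mul, laguerreCoeff_zero] at hK hKi
  -- the optimal parameter in `2 a b ≤ l a ^ 2 + b ^ 2 / l`
  set l := ‖c 0‖ / N with hl
  have hlpos : 0 < l := by positivity
  have h1 : ‖c 0‖ ≤ ∫ r in Ioi (0 : ℝ), ((l / 2) * (radialWeight r * laguerreKernel N r *
        ∑ i ∈ range N, r ^ (2 * i) * laguerreCoeff N i) + (1 / (2 * l)) *
        (radialWeight r * ‖∑ m ∈ range N, r ^ (2 * m) • c m‖ ^ 2)) := by
    conv_lhs => rw [← integral_laguerreKernel_smul hN c]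
    refine (norm_integral_le_integral_norm _).trans ?_
    refine setIntegral_mono_on (integrableOn_laguerreKernel_smul N c).norm
      ((hKi.const_mul _).add (hi.const_mul _)) measurableSet_Ioi fun r hr => ?_
    have hr' : (0 : ℝ) < r := hr
    have hw : 0 ≤ radialWeight r := by
      simp only [radialWeight]
      positivity
    rw [norm_smul, norm_mul, Real.norm_of_nonneg hw]
    change _ ≤ (l / 2) * (radialWeight r * laguerreKernel N r * laguerreKernel N r) + _
    set a := laguerreKernel N r
    set b := ‖∑ m ∈ range N, r ^ (2 * m) • c m‖
    have h2 : ‖a‖ * b ≤ l / 2 * a ^ 2 + 1 / (2 * l) * b ^ 2 := by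
      have h3 : l / 2 * a ^ 2 + 1 / (2 * l) * b ^ 2 - ‖a‖ * b = (l * ‖a‖ - b) ^ 2 / (2 * l) := by
        rw [← sq_abs a, Real.norm_eq_abs]
        field_simp
        ring
      have : 0 ≤ (l * ‖a‖ - b) ^ 2 / (2 * l) := by positivity
      linarith
    nlinarith [mul_le_mul_of_nonneg_left h2 hw]
  rw [integral_add (hKi.const_mul _) (hi.const_mul _), integral_const_mul, integral_const_mul,
    hK, ← hA, hl] at h1
  have h2 : ‖c 0‖ / N / 2 * N + 1 / (2 * (‖c 0‖ / N)) * A =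
      ‖c 0‖ / 2 + N * A / (2 * ‖c 0‖) := by
    field_simp
  rw [h2] at h1
  have h3 : ‖c 0‖ / 2 ≤ N * A / (2 * ‖c 0‖) := by linarith
  rw [le_div_iff₀ (by positivity)] at h3
  nlinarith

end Radial

/-! ### The pointwise bound on the plane -/

section PointwiseBound

open MeasureTheory Set

variable {E : Type*} [NormedAddCommGroup E] [NormedSpace ℂ E]

lemma complex_polarCoord_symm_eq_circleMap (p : ℝ × ℝ) :
    Complex.polarCoord.symm p = circleMap 0 p.1 p.2 := by
  rw [Complex.polarCoord_symm_apply, circleMap_zero, Complex.exp_mul_I]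
  push_cast
  rfl

/-- Polar coordinates and Jensen's inequality on each circle. -/
lemma lintegral_radialWeight_circleAverage_le {F : ℂ → E} (hF : Continuous F) :
    ∫⁻ r in Ioi (0 : ℝ),
        ENNReal.ofReal (Real.pi * (radialWeight r * ‖Real.circleAverage F 0 r‖ ^ 2)) ≤
      ∫⁻ w : ℂ, ENNReal.ofReal (‖F w‖ ^ 2 * Real.exp (-‖w‖ ^ 2)) := by
  rw [← Complex.lintegral_comp_polarCoord_symm]
  simp only [complex_polarCoord_symm_eq_circleMap, polarCoord_target]
  rw [Measure.volume_eq_prod, setLIntegral_prod]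
  swap
  · refine Measurable.aemeasurable ?_
    have : Continuous fun p : ℝ × ℝ => ‖F (circleMap 0 p.1 p.2)‖ ^ 2 *
        Real.exp (-‖circleMap 0 p.1 p.2‖ ^ 2) := by
      have : Continuous fun p : ℝ × ℝ => circleMap 0 p.1 p.2 := Real.circleMap.continuous
      fun_prop
    have := this.measurable
    simp only [smul_eq_mul]
    fun_prop
  refine setLIntegral_mono' measurableSet_Ioi fun r hr => ?_
  have hr' : (0 : ℝ) < r := hr
  have hc : Continuous fun θ => ‖F (circleMap 0 r θ)‖ ^ 2 := by fun_prop
  have h1 : ∫⁻ θ in Ioo (-Real.pi) Real.pi, ENNReal.ofReal (‖F (circleMap 0 r θ)‖ ^ 2) =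
      ENNReal.ofReal (∫ θ in -Real.pi..Real.pi, ‖F (circleMap 0 r θ)‖ ^ 2) := by
    rw [intervalIntegral.integral_of_le (by linarith [Real.pi_pos]), integral_Ioc_eq_integral_Ioo,
      ofReal_integral_eq_lintegral_ofReal]
    · exact hc.integrableOn_Icc.mono_set Ioo_subset_Icc_self
    · exact Filter.Eventually.of_forall fun θ => by positivity
  have h2 : ∀ θ, ENNReal.ofReal r • ENNReal.ofReal (‖F (circleMap 0 r θ)‖ ^ 2 *
      Real.exp (-‖circleMap 0 r θ‖ ^ 2)) = ENNReal.ofReal (r * Real.exp (-r ^ 2)) *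
        ENNReal.ofReal (‖F (circleMap 0 r θ)‖ ^ 2) := fun θ => by
    rw [smul_eq_mul, ← ENNReal.ofReal_mul hr'.le, ← ENNReal.ofReal_mul (by positivity),
      norm_circleMap_zero, sq_abs]
    congr 1
    ring
  simp only [h2]
  rw [lintegral_const_mul' _ _ ENNReal.ofReal_ne_top, h1, ← ENNReal.ofReal_mul (by positivity)]
  refine ENNReal.ofReal_le_ofReal ?_
  have h3 := mul_le_mul_of_nonneg_left (two_pi_mul_norm_circleAverage_sq_le hF r)
    (show 0 ≤ r * Real.exp (-r ^ 2) by positivity)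
  refine le_trans (le_of_eq ?_) h3
  rw [radialWeight]
  ring

variable [CompleteSpace E]

lemma IsPolyentire.norm_sq_zero_le {N : ℕ} (hN : 1 ≤ N) {F : ℂ → E} (hF : IsPolyentire N F)
    (hi : Integrable fun w : ℂ => ‖F w‖ ^ 2 * Real.exp (-‖w‖ ^ 2)) :
    ‖F 0‖ ^ 2 ≤ N / Real.pi * ∫ w : ℂ, ‖F w‖ ^ 2 * Real.exp (-‖w‖ ^ 2) := by
  obtain ⟨c, hc0, hc⟩ := hF.exists_circleAverage_eq hN
  have h1 := lintegral_radialWeight_circleAverage_le hF.continuous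
  rw [← ofReal_integral_eq_lintegral_ofReal hi
    (Filter.Eventually.of_forall fun w => by positivity)] at h1
  simp only [hc] at h1
  have hcont : Continuous fun r : ℝ =>
      Real.pi * (radialWeight r * ‖∑ m ∈ range N, r ^ (2 * m) • c m‖ ^ 2) := by
    unfold radialWeight
    fun_prop
  have hnn : 0 ≤ᵐ[volume.restrict (Ioi 0)] fun r : ℝ =>
      Real.pi * (radialWeight r * ‖∑ m ∈ range N, r ^ (2 * m) • c m‖ ^ 2) := by
    refine (ae_restrict_iff' measurableSet_Ioi).2 (Filter.Eventually.of_forall fun r hr => ?_)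
    have : (0 : ℝ) < r := hr
    simp only [radialWeight, Pi.zero_apply]
    have := Real.pi_pos
    positivity
  have h2 : IntegrableOn (fun r : ℝ =>
      Real.pi * (radialWeight r * ‖∑ m ∈ range N, r ^ (2 * m) • c m‖ ^ 2)) (Ioi 0) := by
    refine ⟨hcont.aestronglyMeasurable, ?_⟩
    rw [hasFiniteIntegral_iff_ofReal hnn]
    exact h1.trans_lt ENNReal.ofReal_lt_top
  rw [← ofReal_integral_eq_lintegral_ofReal h2 hnn, ENNReal.ofReal_le_ofReal_iff
    (integral_nonneg fun w => by positivity), integral_const_mul] at h1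
  have h3 : IntegrableOn (fun r : ℝ =>
      radialWeight r * ‖∑ m ∈ range N, r ^ (2 * m) • c m‖ ^ 2) (Ioi 0) := by
    refine (h2.const_mul Real.pi⁻¹).congr (Filter.Eventually.of_forall fun r => ?_)
    exact inv_mul_cancel_left₀ Real.pi_ne_zero _
  rw [← hc0, div_mul_eq_mul_div, le_div_iff₀ Real.pi_pos]
  have h4 := norm_sq_le_integral_radialWeight hN c h3
  have h5 := mul_le_mul_of_nonneg_left h1 (Nat.cast_nonneg (α := ℝ) N)
  nlinarith [mul_le_mul_of_nonneg_right h4 Real.pi_pos.le]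

/-- The bound at an arbitrary point follows from the one at the origin through the unitary
Weyl operators `F ↦ exp (-conj z * w - |z|^2 / 2) F (w + z)`, which preserve the order. -/
theorem IsPolyentire.norm_sq_le {N : ℕ} (hN : 1 ≤ N) {F : ℂ → E} (hF : IsPolyentire N F)
    (hi : Integrable fun w : ℂ => ‖F w‖ ^ 2 * Real.exp (-‖w‖ ^ 2)) (z : ℂ) :
    ‖F z‖ ^ 2 ≤ N / Real.pi * Real.exp (‖z‖ ^ 2) *
      ∫ w : ℂ, ‖F w‖ ^ 2 * Real.exp (-‖w‖ ^ 2) := by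
  have hG : IsPolyentire N fun w => Complex.exp (-(conj z * w)) • F (w + z) :=
    (hF.comp_add_const z).entire_smul (by fun_prop)
  have h1 : ∀ w : ℂ, ‖Complex.exp (-(conj z * w)) • F (w + z)‖ ^ 2 * Real.exp (-‖w‖ ^ 2) =
      Real.exp (‖z‖ ^ 2) * (‖F (w + z)‖ ^ 2 * Real.exp (-‖w + z‖ ^ 2)) := fun w => by
    have h2 : ‖w + z‖ ^ 2 = ‖w‖ ^ 2 + ‖z‖ ^ 2 + 2 * (conj z * w).re := by
      simp only [← Complex.normSq_eq_norm_sq, Complex.normSq_apply, Complex.add_re,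
        Complex.add_im, Complex.mul_re, Complex.conj_re, Complex.conj_im]
      ring
    rw [norm_smul, Complex.norm_exp, mul_pow, h2, ← Real.exp_nat_mul, Complex.neg_re]
    have h3 : Real.exp ((2 : ℕ) * -(conj z * w).re) * Real.exp (-‖w‖ ^ 2) =
        Real.exp (‖z‖ ^ 2) * Real.exp (-(‖w‖ ^ 2 + ‖z‖ ^ 2 + 2 * (conj z * w).re)) := by
      rw [← Real.exp_add, ← Real.exp_add]
      congr 1
      push_cast
      ring
    linear_combination ‖F (w + z)‖ ^ 2 * h3
  have h4 := hG.norm_sq_zero_le hN (by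
    simp only [h1]
    exact (hi.comp_add_right z).const_mul _)
  simp only [h1] at h4
  rw [integral_const_mul,
    integral_add_right_eq_self (fun w : ℂ => ‖F w‖ ^ 2 * Real.exp (-‖w‖ ^ 2)) z] at h4
  simpa [mul_assoc] using h4

end PointwiseBound

/-! ### Locally uniform limits of polyanalytic functions -/

section Limits

open Filter

variable {E : Type*} [NormedAddCommGroup E] [NormedSpace ℂ E]

/-- Each component of a polynomial of degree less than `N` is a linear combination of its values
at `N` distinct nodes. -/
lemma exists_coeff_eq_sum_values (N : ℕ) {t : Fin N → ℂ} (ht : Function.Injective t) (k : Fin N) :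
    ∃ c : Fin N → ℂ, ∀ x : Fin N → E, ∑ j, c j • ∑ l : Fin N, t j ^ (l : ℕ) • x l = x k := by
  have hdet : IsUnit (Matrix.vandermonde t).det :=
    (Matrix.det_vandermonde_ne_zero_iff.2 ht).isUnit
  refine ⟨fun j => (Matrix.vandermonde t)⁻¹ k j, fun x => ?_⟩
  have h1 := Matrix.nonsing_inv_mul _ hdet
  have h2 : ∀ l : Fin N, ∑ j, (Matrix.vandermonde t)⁻¹ k j * t j ^ (l : ℕ) =
      if k = l then 1 else 0 := by
    intro l
    have := congrFun (congrFun h1 k) l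
    rwa [Matrix.mul_apply, Matrix.one_apply] at this
  simp only [smul_sum, smul_smul]
  rw [sum_comm]
  simp only [← sum_smul, h2]
  simp

lemma norm_le_of_norm_le_sphere {H : ℂ → E} (hH : Differentiable ℂ H) {r C : ℝ} (hr : 0 < r)
    (hC : ∀ z, ‖z‖ = r → ‖H z‖ ≤ C) {z : ℂ} (hz : ‖z‖ ≤ r) : ‖H z‖ ≤ C := by
  refine Complex.norm_le_of_forall_mem_frontier_norm_le (U := Metric.ball 0 r)
    Metric.isBounded_ball hH.diffContOnCl (fun w hw => hC w ?_) ?_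
  · rw [frontier_ball _ hr.ne'] at hw
    simpa using hw
  · rw [closure_ball _ hr.ne']
    simpa using hz

/-- The entire components of a polyanalytic function are controlled by its values. On the circle of
radius `r`, the function `z ^ (N - 1) • F z` agrees with the entire function
`∑ l, (r ^ 2) ^ l • z ^ (N - 1 - l) • h l z`, so the latter is bounded on the disc by the maximum
principle; using `N` different radii one solves for the components. -/
lemma exists_norm_component_le (N : ℕ) {k : ℕ} (hk : k < N) {R : ℝ} (hR : 0 < R) :
    ∃ C : ℝ, 0 ≤ C ∧ ∀ (h : ℕ → ℂ → E), (∀ l, Differentiable ℂ (h l)) → ∀ M : ℝ,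
      (∀ z : ℂ, ‖z‖ ≤ 2 * R → ‖∑ l ∈ range N, conj z ^ l • h l z‖ ≤ M) →
      ∀ z : ℂ, ‖z‖ ≤ R → ‖h k z‖ ≤ C * M := by
  have hN : (0 : ℝ) < N := by exact_mod_cast (by omega : 0 < N)
  -- the radii, distinct points of `[R, 2 R)`
  let r : Fin N → ℝ := fun j => R * (1 + (j : ℕ) / N)
  have hr1 : ∀ j, R ≤ r j := fun j => by
    have : (0 : ℝ) ≤ (j : ℕ) / N := by positivity
    simp only [r]
    nlinarith
  have hr2 : ∀ j, r j ≤ 2 * R := fun j => by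
    have : ((j : ℕ) : ℝ) / N ≤ 1 := by
      rw [div_le_one hN]
      exact_mod_cast j.2.le
    simp only [r]
    nlinarith
  have hinj : Function.Injective fun j => ((r j ^ 2 : ℝ) : ℂ) := by
    intro i j hij
    have h1 : r i ^ 2 = r j ^ 2 := Complex.ofReal_injective hij
    have h2 : r i = r j :=
      (pow_left_inj₀ (hR.le.trans (hr1 i)) (hR.le.trans (hr1 j)) two_ne_zero).1 h1
    have h3 : ((i : ℕ) : ℝ) / N = (j : ℕ) / N := by
      have := mul_left_cancel₀ hR.ne' h2
      linarith
    rw [div_left_inj' hN.ne'] at h3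
    exact Fin.ext (by exact_mod_cast h3)
  obtain ⟨c, hc⟩ := exists_coeff_eq_sum_values (E := E) N hinj ⟨k, hk⟩
  refine ⟨(∑ j, ‖c j‖ * (2 * R) ^ (N - 1)) / R ^ (N - 1 - k), by positivity,
    fun h hh M hM z hz => ?_⟩
  have hM0 : 0 ≤ M := (norm_nonneg _).trans (hM 0 (by simpa using hR.le))
  let H : Fin N → ℂ → E := fun j z =>
    ∑ l : Fin N, ((r j ^ 2 : ℝ) : ℂ) ^ (l : ℕ) • z ^ (N - 1 - (l : ℕ)) • h l z
  have hHd : ∀ j, Differentiable ℂ (H j) := fun j =>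
    Differentiable.fun_sum fun l _ =>
      (((differentiable_id.pow _).smul (hh l)).const_smul _)
  have hHb : ∀ j, ∀ z, ‖z‖ ≤ R → ‖H j z‖ ≤ (2 * R) ^ (N - 1) * M := by
    intro j z hz
    refine norm_le_of_norm_le_sphere (hHd j) (hR.trans_le (hr1 j)) (fun w hw => ?_)
      (hz.trans (hr1 j))
    have h1 : H j w = w ^ (N - 1) • ∑ l ∈ range N, conj w ^ l • h l w := by
      simp only [H]
      rw [sum_range, smul_sum]
      refine sum_congr rfl fun l _ => ?_
      have h2 : ((r j ^ 2 : ℝ) : ℂ) = w * conj w := by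
        rw [Complex.mul_conj, Complex.normSq_eq_norm_sq, hw]
      have h3 : w ^ (N - 1) = w ^ (l : ℕ) * w ^ (N - 1 - l) := by
        rw [← pow_add]
        congr 1
        have := l.2
        omega
      rw [smul_smul, smul_smul, h2, h3, mul_pow]
      congr 1
      ring
    rw [h1, norm_smul, norm_pow, hw]
    have h2 := hM w (hw.trans_le (hr2 j))
    have h3 : r j ^ (N - 1) ≤ (2 * R) ^ (N - 1) :=
      pow_le_pow_left₀ (hR.le.trans (hr1 j)) (hr2 j) _
    exact mul_le_mul h3 h2 (norm_nonneg _) (by positivity)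
  refine norm_le_of_norm_le_sphere (hh k) hR (fun w hw => ?_) hz
  have h1 : w ^ (N - 1 - k) • h k w = ∑ j, c j • H j w :=
    (hc fun l => w ^ (N - 1 - (l : ℕ)) • h l w).symm
  have h2 : R ^ (N - 1 - k) * ‖h k w‖ ≤ (∑ j, ‖c j‖ * (2 * R) ^ (N - 1)) * M := by
    calc R ^ (N - 1 - k) * ‖h k w‖ = ‖∑ j, c j • H j w‖ := by
          rw [← h1, norm_smul, norm_pow, hw]
      _ ≤ ∑ j, ‖c j • H j w‖ := norm_sum_le _ _
      _ ≤ ∑ j, ‖c j‖ * ((2 * R) ^ (N - 1) * M) := sum_le_sum fun j _ => by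
          rw [norm_smul]
          exact mul_le_mul_of_nonneg_left (hHb j w hw.le) (norm_nonneg _)
      _ = _ := by
          rw [sum_mul]
          exact sum_congr rfl fun j _ => by ring
  rw [div_mul_eq_mul_div, le_div_iff₀ (by positivity)]
  linarith

variable [CompleteSpace E]

/-- A sequence of polyanalytic functions of order `N` that is uniformly Cauchy on every disc
converges pointwise to a polyanalytic function of order `N`. -/
theorem IsPolyentire.exists_tendsto {N : ℕ} {F : ℕ → ℂ → E} (hF : ∀ n, IsPolyentire N (F n))
    (hcau : ∀ R : ℝ, UniformCauchySeqOn F atTop (Metric.closedBall 0 R)) :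
    ∃ G : ℂ → E, IsPolyentire N G ∧ ∀ z, Tendsto (fun n => F n z) atTop (𝓝 (G z)) := by
  choose h hd hF using hF
  have hcomp : ∀ k < N, ∀ R > 0,
      UniformCauchySeqOn (fun n => h n k) atTop (Metric.closedBall 0 R) := by
    intro k hk R hR
    obtain ⟨C, hC0, hC⟩ := exists_norm_component_le (E := E) N hk hR
    rw [Metric.uniformCauchySeqOn_iff]
    intro ε hε
    obtain ⟨M, hM⟩ := Metric.uniformCauchySeqOn_iff.1 (hcau (2 * R)) (ε / (C + 1)) (by positivity)
    refine ⟨M, fun m hm n hn z hz => ?_⟩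
    have h1 := hC (fun l z => h m l z - h n l z) (fun l => (hd m l).sub (hd n l)) (ε / (C + 1))
      (fun w hw => by
        have := (hM m hm n hn w (by simpa using hw)).le
        rw [dist_eq_norm, hF, hF, ← sum_sub_distrib] at this
        simpa only [smul_sub] using this) z (by simpa using hz)
    rw [dist_eq_norm]
    refine h1.trans_lt ?_
    rw [mul_div_assoc', div_lt_iff₀ (by positivity)]
    nlinarith
  have hlim : ∀ k < N, ∃ g : ℂ → E, Differentiable ℂ g ∧
      ∀ z, Tendsto (fun n => h n k z) atTop (𝓝 (g z)) := by
    intro k hk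
    have h1 : ∀ z, ∃ a, Tendsto (fun n => h n k z) atTop (𝓝 a) := fun z =>
      cauchySeq_tendsto_of_complete
        ((hcomp k hk (‖z‖ + 1) (by positivity)).cauchySeq (x := z) (by simp))
    choose g hg using h1
    refine ⟨g, ?_, hg⟩
    rw [← differentiableOn_univ]
    refine TendstoLocallyUniformlyOn.differentiableOn (F := fun n => h n k) (φ := atTop) ?_
      (Eventually.of_forall fun n => (hd n k).differentiableOn) isOpen_univ
    intro u hu z _
    refine ⟨Metric.closedBall 0 (‖z‖ + 1),
      mem_nhdsWithin_of_mem_nhds ?_, ?_⟩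
    · refine Filter.mem_of_superset (Metric.ball_mem_nhds z one_pos) fun w hw => ?_
      have h2 : ‖w‖ ≤ ‖z‖ + ‖w - z‖ := norm_le_insert' w z
      rw [mem_ball_iff_norm] at hw
      rw [mem_closedBall_zero_iff]
      linarith
    · exact (hcomp k hk (‖z‖ + 1) (by positivity)).tendstoUniformlyOn_of_tendsto
        (fun w _ => hg w) u hu
  choose! g hgd hg using hlim
  refine ⟨fun z => ∑ k ∈ range N, conj z ^ k • g k z, ?_, fun z => ?_⟩
  · exact IsPolyentire.sum _ fun k hk =>
      .conj_pow_smul (mem_range.1 hk) (hgd k (mem_range.1 hk))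
  · simp only [hF]
    exact tendsto_finsetSum _ fun k hk => (hg k (mem_range.1 hk) z).const_smul _

end Limits

/-! ### Iterated differentiability without continuity of the last derivative -/

section DirDiff

variable {U V W : Type*} [NormedAddCommGroup U] [NormedSpace ℝ U] [NormedAddCommGroup V]
  [NormedSpace ℝ V] [NormedAddCommGroup W] [NormedSpace ℝ W]

/-- `f` is differentiable, and so are its directional derivatives up to order `n - 1`. Unlike
`iteratedFDeriv`, the iterated directional derivatives keep the codomain fixed. -/
def DirDiff : ℕ → (V → W) → Prop
  | 0, _ => True
  | n + 1, f => Differentiable ℝ f ∧ ∀ v, DirDiff n fun x => fderiv ℝ f x v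

/-- Below the top order `f` is continuously differentiable, so evaluation of `fderiv ℝ f` at a fixed
vector commutes with the remaining iterated derivatives. -/
lemma dirDiff_of_differentiable_iteratedFDeriv {N : ℕ} {f : V → W}
    (hf : ∀ m < N, Differentiable ℝ (iteratedFDeriv ℝ m f)) : DirDiff N f := by
  induction N generalizing f with
  | zero => trivial
  | succ N ih =>
    have hcd : ContDiff ℝ N f := contDiff_of_differentiable_iteratedFDeriv (n := N)
      fun m hm => hf m (by have : m ≤ N := by exact_mod_cast hm
                           omega)
    refine ⟨?_, fun v => ih fun m hm => ?_⟩
    · have h0 := hf 0 (by omega)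
      rw [iteratedFDeriv_zero_eq_comp] at h0
      exact ((continuousMultilinearCurryFin0 ℝ V W).symm.comp_differentiable_iff).1 h0
    · have h1 : ContDiff ℝ m (fderiv ℝ f) := hcd.fderiv_right (by exact_mod_cast hm)
      have h2 : Differentiable ℝ (iteratedFDeriv ℝ m (fderiv ℝ f)) := by
        have h3 := hf (m + 1) (by omega)
        have h4 : iteratedFDeriv ℝ (m + 1) f =
            (continuousMultilinearCurryRightEquiv' ℝ m V W).symm ∘
              iteratedFDeriv ℝ m (fderiv ℝ f) := by
          ext1 x
          exact iteratedFDeriv_succ_eq_comp_right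
        rw [h4] at h3
        exact ((continuousMultilinearCurryRightEquiv' ℝ m V W).symm.comp_differentiable_iff).1 h3
      let L : (V →L[ℝ] W) →L[ℝ] W := ContinuousLinearMap.apply ℝ W v
      have h5 : iteratedFDeriv ℝ m (fun x => fderiv ℝ f x v) = fun x =>
          ContinuousLinearMap.compContinuousMultilinearMapL ℝ (fun _ : Fin m => V) (V →L[ℝ] W) W L
            (iteratedFDeriv ℝ m (fderiv ℝ f) x) := by
        ext1 x
        exact L.iteratedFDeriv_comp_left h1.contDiffAt le_rfl
      rw [h5]
      exact (ContinuousLinearMap.differentiable _).comp h2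

namespace DirDiff

lemma add {n : ℕ} {f g : V → W} (hf : DirDiff n f) (hg : DirDiff n g) :
    DirDiff n fun x => f x + g x := by
  induction n generalizing f g with
  | zero => trivial
  | succ n ih =>
    refine ⟨hf.1.add hg.1, fun v => ?_⟩
    have h1 : (fun x => fderiv ℝ (fun x => f x + g x) x v) =
        fun x => fderiv ℝ f x v + fderiv ℝ g x v := by
      ext1 x
      rw [fderiv_fun_add (hf.1 x) (hg.1 x)]
      rfl
    rw [h1]
    exact ih (hf.2 v) (hg.2 v)

lemma comp_left {n : ℕ} {f : V → W} (hf : DirDiff n f) (L : W →L[ℝ] U) :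
    DirDiff n fun x => L (f x) := by
  induction n generalizing f with
  | zero => trivial
  | succ n ih =>
    refine ⟨L.differentiable.comp hf.1, fun v => ?_⟩
    have h1 : (fun x => fderiv ℝ (fun x => L (f x)) x v) = fun x => L (fderiv ℝ f x v) := by
      ext1 x
      exact congrArg (fun A : V →L[ℝ] U => A v) (L.hasFDerivAt.comp x (hf.1 x).hasFDerivAt).fderiv
    rw [h1]
    exact ih (hf.2 v)

lemma comp_right {n : ℕ} {f : V → W} (hf : DirDiff n f) (L : U →L[ℝ] V) :
    DirDiff n fun x => f (L x) := by
  induction n generalizing f with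
  | zero => trivial
  | succ n ih =>
    refine ⟨hf.1.comp L.differentiable, fun v => ?_⟩
    have h1 : (fun x => fderiv ℝ (fun x => f (L x)) x v) = fun x => fderiv ℝ f (L x) (L v) := by
      ext1 x
      exact congrArg (fun A : U →L[ℝ] W => A v)
        ((hf.1 (L x)).hasFDerivAt.comp x L.hasFDerivAt).fderiv
    rw [h1]
    exact ih (hf.2 (L v))

lemma wirtinger {E : Type*} [NormedAddCommGroup E] [NormedSpace ℂ E] {n : ℕ} {F : ℂ → E}
    (hF : DirDiff (n + 1) F) : DirDiff n (wirtinger F) := by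
  let L : E →L[ℝ] E := (1 / 2 : ℝ) • ContinuousLinearMap.id ℝ E
  let M : E →L[ℝ] E :=
    ((Complex.I • ContinuousLinearMap.id ℂ E : E →L[ℂ] E)).restrictScalars ℝ
  exact ((hF.2 1).add ((hF.2 Complex.I).comp_left M)).comp_left L

lemma differentiable_wirtinger_iterate {E : Type*} [NormedAddCommGroup E] [NormedSpace ℂ E]
    {N : ℕ} {F : ℂ → E} (hF : DirDiff N F) :
    ∀ m < N, Differentiable ℝ (SliceFock.wirtinger^[m] F) := by
  intro m hm
  induction m generalizing N F with
  | zero =>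
    obtain ⟨N, rfl⟩ : ∃ k, N = k + 1 := ⟨N - 1, by omega⟩
    exact hF.1
  | succ m ih =>
    obtain ⟨N, rfl⟩ : ∃ k, N = k + 1 := ⟨N - 1, by omega⟩
    exact ih hF.wirtinger (by omega)

end DirDiff

end DirDiff

/-! ### The slices of the quaternions as complex planes -/

section Slices

lemma star_of_mem_imagUnits {J : ℍ[ℝ]} (hJ : J ∈ imagUnits) : star J = -J := by
  have h : J ^ 2 = -1 := hJ
  rw [pow_two] at h
  have h0 := congrArg QuaternionAlgebra.re h
  have h1 := congrArg QuaternionAlgebra.imI h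
  have h2 := congrArg QuaternionAlgebra.imJ h
  have h3 := congrArg QuaternionAlgebra.imK h
  simp at h0 h1 h2 h3
  have hre : J.re = 0 := by
    by_contra hne
    have e1 : J.imI = 0 := mul_left_cancel₀ hne (by linarith)
    have e2 : J.imJ = 0 := mul_left_cancel₀ hne (by linarith)
    have e3 : J.imK = 0 := mul_left_cancel₀ hne (by linarith)
    rw [e1, e2, e3] at h0
    nlinarith
  ext <;> simp [hre]

lemma mul_self_of_mem_imagUnits {J : ℍ[ℝ]} (hJ : J ∈ imagUnits) : J * J = -1 := by
  rw [← pow_two]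
  exact hJ

lemma norm_of_mem_imagUnits {J : ℍ[ℝ]} (hJ : J ∈ imagUnits) : ‖J‖ = 1 := by
  have h : ‖J‖ ^ 2 = 1 := by
    rw [← norm_pow, show J ^ 2 = -1 from hJ, norm_neg, norm_one]
  exact (pow_eq_one_iff_of_nonneg (norm_nonneg _) two_ne_zero).1 h

/-- The embedding of the complex numbers onto the slice `ℝ + J ℝ` that maps `i` to `J`. -/
def sliceEmb (J : imagUnits) : ℂ →ₐ[ℝ] ℍ[ℝ] :=
  Complex.lift ⟨J, mul_self_of_mem_imagUnits J.2⟩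

lemma sliceEmb_apply (J : imagUnits) (z : ℂ) :
    sliceEmb J z = (z.re : ℍ[ℝ]) + (J : ℍ[ℝ]) * (z.im : ℍ[ℝ]) := by
  change algebraMap ℝ ℍ[ℝ] z.re + z.im • (J : ℍ[ℝ]) = _
  rw [Quaternion.mul_coe_eq_smul]
  rfl

lemma slicePt_eq_sliceEmb (J : imagUnits) (x y : ℝ) : slicePt J x y = sliceEmb J ⟨x, y⟩ := by
  rw [sliceEmb_apply]
  rfl

lemma star_sliceEmb (J : imagUnits) (z : ℂ) : star (sliceEmb J z) = sliceEmb J (conj z) := by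
  simp only [sliceEmb_apply, star_add, star_mul, Quaternion.star_coe, star_of_mem_imagUnits J.2,
    Complex.conj_re, Complex.conj_im, Quaternion.coe_neg, mul_neg]
  rw [Quaternion.coe_commutes]

lemma norm_sliceEmb (J : imagUnits) (z : ℂ) : ‖sliceEmb J z‖ = ‖z‖ := by
  have h : ‖sliceEmb J z‖ ^ 2 = ‖z‖ ^ 2 := by
    have h1 : star (sliceEmb J z) * sliceEmb J z = ((‖z‖ ^ 2 : ℝ) : ℍ[ℝ]) := by
      rw [star_sliceEmb, ← map_mul, ← Complex.normSq_eq_conj_mul_self,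
        Complex.normSq_eq_norm_sq, sliceEmb_apply, Complex.ofReal_re, Complex.ofReal_im,
        Quaternion.coe_zero, mul_zero, add_zero]
    have h2 := congrArg norm h1
    rw [norm_mul, norm_star, Quaternion.norm_coe, Real.norm_of_nonneg (by positivity)] at h2
    rw [pow_two, h2]
  exact (pow_left_inj₀ (norm_nonneg _) (norm_nonneg _) two_ne_zero).1 h

lemma exists_eq_sliceEmb (q : ℍ[ℝ]) : ∃ (J : imagUnits) (z : ℂ), q = sliceEmb J z := by
  by_cases h : q.im = 0
  · have hi : Quaternion.ofComplex Complex.I ∈ imagUnits := by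
      change Quaternion.ofComplex Complex.I ^ 2 = -1
      rw [← map_pow, Complex.I_sq, map_neg, map_one]
    refine ⟨⟨_, hi⟩, ⟨q.re, 0⟩, ?_⟩
    rw [sliceEmb_apply]
    conv_lhs => rw [← Quaternion.re_add_im q, h]
    simp
  · have hn : ‖q.im‖ ≠ 0 := norm_ne_zero_iff.2 h
    have hJ : ‖q.im‖⁻¹ • q.im ∈ imagUnits := by
      change (‖q.im‖⁻¹ • q.im) ^ 2 = -1
      have h1 : q.im * q.im = -((‖q.im‖ ^ 2 : ℝ) : ℍ[ℝ]) := by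
        have h2 : star q.im = -q.im := by ext <;> simp
        have h3 := Quaternion.self_mul_star q.im
        rw [h2, mul_neg, Quaternion.normSq_eq_norm_mul_self] at h3
        rw [pow_two, ← h3, neg_neg]
      rw [smul_pow, pow_two q.im, h1, smul_neg, ← Quaternion.coe_smul, smul_eq_mul, ← mul_pow,
        inv_mul_cancel₀ hn, one_pow, Quaternion.coe_one]
    refine ⟨⟨_, hJ⟩, ⟨q.re, ‖q.im‖⟩, ?_⟩
    rw [sliceEmb_apply, Quaternion.mul_coe_eq_smul]
    change q = q.re + ‖q.im‖ • (‖q.im‖⁻¹ • q.im)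
    rw [smul_smul, mul_inv_cancel₀ hn, one_smul, Quaternion.re_add_im]

/-- The quaternions as a complex vector space, the complex unit acting by left multiplication
by `J`. -/
def SliceSpace (_J : imagUnits) : Type := ℍ[ℝ]

variable (J : imagUnits)

instance : NormedAddCommGroup (SliceSpace J) := inferInstanceAs (NormedAddCommGroup ℍ[ℝ])

instance : CompleteSpace (SliceSpace J) := inferInstanceAs (CompleteSpace ℍ[ℝ])

instance : Module ℂ (SliceSpace J) := Module.compHom ℍ[ℝ] (sliceEmb J).toRingHom

instance : NormedSpace ℂ (SliceSpace J) where
  norm_smul_le z q := by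
    change ‖sliceEmb J z * (show ℍ[ℝ] from q)‖ ≤ ‖z‖ * ‖(show ℍ[ℝ] from q)‖
    rw [norm_mul, norm_sliceEmb]

/-- The identity map from the quaternions to the complex vector space `SliceSpace J`. -/
def toSlice : ℍ[ℝ] ≃ₗᵢ[ℝ] SliceSpace J where
  toFun q := q
  invFun q := q
  left_inv _ := rfl
  right_inv _ := rfl
  map_add' _ _ := rfl
  map_smul' r q := by
    change r • q = sliceEmb J (r : ℂ) * q
    rw [sliceEmb_apply]
    simp [Quaternion.coe_mul_eq_smul]
  norm_map' _ := rfl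

lemma toSlice_sliceEmb_mul (z : ℂ) (q : ℍ[ℝ]) :
    toSlice J (sliceEmb J z * q) = z • toSlice J q := rfl

lemma toSlice_symm_smul (z : ℂ) (q : SliceSpace J) :
    (toSlice J).symm (z • q) = sliceEmb J z * (toSlice J).symm q := rfl

/-- The restriction of a function of a quaternion variable to a slice. -/
def sliceRestrict (f : ℍ[ℝ] → ℍ[ℝ]) (z : ℂ) : SliceSpace J := toSlice J (f (sliceEmb J z))

lemma norm_sliceRestrict (f : ℍ[ℝ] → ℍ[ℝ]) (z : ℂ) :
    ‖sliceRestrict J f z‖ = ‖f (sliceEmb J z)‖ := rfl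

lemma DirDiff.sliceRestrict {N : ℕ} {f : ℍ[ℝ] → ℍ[ℝ]} (hf : DirDiff N f) :
    DirDiff N (sliceRestrict J f) :=
  (hf.comp_left (toSlice J).toContinuousLinearEquiv.toContinuousLinearMap).comp_right
    (LinearMap.toContinuousLinearMap (sliceEmb J).toLinearMap)

lemma dbar_toSlice_symm {F : ℂ → SliceSpace J} (hF : Differentiable ℝ F) :
    dbar J (fun s t => (toSlice J).symm (F ⟨s, t⟩)) =
      fun s t => (toSlice J).symm (wirtinger F ⟨s, t⟩) := by
  ext1 x
  ext1 y
  let e : SliceSpace J →L[ℝ] ℍ[ℝ] := (toSlice J).symm.toContinuousLinearEquiv.toContinuousLinearMap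
  have h1 : HasFDerivAt (fun z => e (F z)) (e.comp (fderiv ℝ F ⟨x, y⟩)) ⟨x, y⟩ :=
    e.hasFDerivAt.comp _ (hF _).hasFDerivAt
  have hx : HasDerivAt (fun s : ℝ => (⟨s, y⟩ : ℂ)) 1 x := by
    have : (fun s : ℝ => (⟨s, y⟩ : ℂ)) = fun s : ℝ => (s : ℂ) + y * Complex.I := by
      ext1 s
      exact Complex.mk_eq_add_mul_I s y
    rw [this]
    exact (Complex.ofRealCLM.hasDerivAt (x := x)).add_const _
  have hy : HasDerivAt (fun t : ℝ => (⟨x, t⟩ : ℂ)) Complex.I y := by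
    have : (fun t : ℝ => (⟨x, t⟩ : ℂ)) = fun t : ℝ => (x : ℂ) + t * Complex.I := by
      ext1 t
      exact Complex.mk_eq_add_mul_I x t
    rw [this]
    simpa using ((Complex.ofRealCLM.hasDerivAt (x := y)).mul_const Complex.I).const_add (x : ℂ)
  have h2 : deriv (fun s : ℝ => (toSlice J).symm (F ⟨s, y⟩)) x =
      e (fderiv ℝ F ⟨x, y⟩ 1) := by
    have := h1.comp_hasDerivAt x hx
    exact this.deriv
  have h3 : deriv (fun t : ℝ => (toSlice J).symm (F ⟨x, t⟩)) y =
      e (fderiv ℝ F ⟨x, y⟩ Complex.I) := by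
    have := h1.comp_hasDerivAt y hy
    exact this.deriv
  have h4 : (J : ℍ[ℝ]) = sliceEmb J Complex.I := by simp [sliceEmb_apply]
  rw [dbar, h2, h3, wirtinger, map_smul, map_add, toSlice_symm_smul, ← h4]
  rfl

lemma dbar_iterate_toSlice_symm {N : ℕ} {F : ℂ → SliceSpace J}
    (hF : ∀ m < N, Differentiable ℝ (wirtinger^[m] F)) {m : ℕ} (hm : m ≤ N) :
    (dbar J)^[m] (fun s t => (toSlice J).symm (F ⟨s, t⟩)) =
      fun s t => (toSlice J).symm (wirtinger^[m] F ⟨s, t⟩) := by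
  induction m with
  | zero => rfl
  | succ m ih =>
    rw [Function.iterate_succ_apply', ih (by omega), dbar_toSlice_symm J (hF m (by omega)),
      Function.iterate_succ_apply']

/-- The equations `dbar ^ N f = 0` on a slice, in terms of the Wirtinger derivative. -/
lemma dbar_iterate_eq_zero_iff {N : ℕ} {f : ℍ[ℝ] → ℍ[ℝ]}
    (hf : ∀ m < N, Differentiable ℝ (wirtinger^[m] (sliceRestrict J f))) :
    (∀ x y : ℝ, (dbar J)^[N] (fun s t => f (slicePt J s t)) x y = 0) ↔
      ∀ z, wirtinger^[N] (sliceRestrict J f) z = 0 := by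
  have h1 : (fun s t => f (slicePt J s t)) =
      fun s t => (toSlice J).symm (sliceRestrict J f ⟨s, t⟩) := by
    ext1 s
    ext1 t
    rw [slicePt_eq_sliceEmb]
    rfl
  rw [h1, dbar_iterate_toSlice_symm J hf le_rfl]
  simp only [EmbeddingLike.map_eq_zero_iff]
  exact ⟨fun h z => h z.re z.im, fun h x y => h ⟨x, y⟩⟩

end Slices

/-! ### Quaternionic power series and slice polyanalytic functions -/

section PowerSeries

/-- The quaternionic power series with coefficients `a` converges absolutely everywhere. -/
def EntireCoeff (a : ℕ → ℍ[ℝ]) : Prop := ∀ r : ℝ, 0 ≤ r → Summable fun n => ‖a n‖ * r ^ n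

/-- The sum `∑ q ^ n * a n` of a quaternionic power series with coefficients on the right. -/
def qSeries (a : ℕ → ℍ[ℝ]) (q : ℍ[ℝ]) : ℍ[ℝ] := ∑' n, q ^ n * a n

/-- Functions of the form `f q = ∑_{k < N} star q ^ k * ∑ n, q ^ n * a k n` with everywhere
convergent power series. -/
def IsPolySeries (N : ℕ) (f : ℍ[ℝ] → ℍ[ℝ]) : Prop :=
  ∃ a : ℕ → ℕ → ℍ[ℝ], (∀ k, EntireCoeff (a k)) ∧
    ∀ q, f q = ∑ k ∈ range N, star q ^ k * qSeries (a k) q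

namespace EntireCoeff

variable {a b : ℕ → ℍ[ℝ]}

lemma summable_norm (ha : EntireCoeff a) (q : ℍ[ℝ]) : Summable fun n => ‖q ^ n * a n‖ := by
  refine (ha ‖q‖ (norm_nonneg q)).congr fun n => ?_
  rw [norm_mul, norm_pow, mul_comm]

lemma summable (ha : EntireCoeff a) (q : ℍ[ℝ]) : Summable fun n => q ^ n * a n :=
  (ha.summable_norm q).of_norm

lemma add (ha : EntireCoeff a) (hb : EntireCoeff b) : EntireCoeff fun n => a n + b n := by
  intro r hr
  refine Summable.of_nonneg_of_le (fun n => by positivity) (fun n => ?_) ((ha r hr).add (hb r hr))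
  rw [← add_mul]
  exact mul_le_mul_of_nonneg_right (norm_add_le _ _) (by positivity)

lemma mul_const (ha : EntireCoeff a) (c : ℍ[ℝ]) : EntireCoeff fun n => a n * c := by
  intro r hr
  refine ((ha r hr).mul_right ‖c‖).congr fun n => ?_
  rw [norm_mul]
  ring

/-- The terms of the series are restrictions to the diagonal of multilinear maps. -/
lemma contDiff (ha : EntireCoeff a) : ContDiff ℝ ⊤ (qSeries a) := by
  let p : FormalMultilinearSeries ℝ ℍ[ℝ] ℍ[ℝ] := fun n =>
    ((ContinuousLinearMap.mul ℝ ℍ[ℝ]).flip (a n)).compContinuousMultilinearMap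
      (ContinuousMultilinearMap.mkPiAlgebraFin ℝ n ℍ[ℝ])
  have hp : ∀ n, ‖p n‖ ≤ ‖a n‖ := fun n => by
    refine (ContinuousLinearMap.norm_compContinuousMultilinearMap_le _ _).trans ?_
    rw [ContinuousMultilinearMap.norm_mkPiAlgebraFin, mul_one]
    exact ContinuousLinearMap.opNorm_le_bound _ (norm_nonneg _) fun x => by
      rw [ContinuousLinearMap.flip_apply, ContinuousLinearMap.mul_apply', norm_mul, mul_comm]
  have hr : p.radius = ⊤ := p.radius_eq_top_of_summable_norm fun r =>
    Summable.of_nonneg_of_le (fun n => by positivity)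
      (fun n => mul_le_mul_of_nonneg_right (hp n) (by positivity)) (ha r r.2)
  have hs : p.sum = qSeries a := by
    ext1 q
    refine tsum_congr fun n => ?_
    simp [p]
  have hb := p.hasFPowerSeriesOnBall (by rw [hr]; exact ENNReal.zero_lt_top)
  rw [hs, hr] at hb
  have h := hb.analyticOnNhd
  rw [Metric.eball_top] at h
  exact h.contDiff

end EntireCoeff

lemma qSeries_add {a b : ℕ → ℍ[ℝ]} (ha : EntireCoeff a) (hb : EntireCoeff b) (q : ℍ[ℝ]) :
    qSeries (fun n => a n + b n) q = qSeries a q + qSeries b q := by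
  simp only [qSeries, mul_add]
  exact (ha.summable q).tsum_add (hb.summable q)

lemma qSeries_mul_const (a : ℕ → ℍ[ℝ]) (c q : ℍ[ℝ]) :
    qSeries (fun n => a n * c) q = qSeries a q * c := by
  simp only [qSeries, ← mul_assoc]
  exact tsum_mul_right

/-- Quaternionic conjugation as a real linear map. -/
def starLinear : ℍ[ℝ] →ₗ[ℝ] ℍ[ℝ] where
  toFun := star
  map_add' := star_add
  map_smul' r q := Quaternion.star_smul r q

namespace IsPolySeries

variable {N : ℕ} {f g : ℍ[ℝ] → ℍ[ℝ]}

lemma zero (N : ℕ) : IsPolySeries N 0 :=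
  ⟨fun _ _ => 0, fun _ _ _ => by simp, fun q => by simp [qSeries]⟩

lemma add (hf : IsPolySeries N f) (hg : IsPolySeries N g) : IsPolySeries N (f + g) := by
  obtain ⟨a, ha, hf⟩ := hf
  obtain ⟨b, hb, hg⟩ := hg
  refine ⟨fun k n => a k n + b k n, fun k => (ha k).add (hb k), fun q => ?_⟩
  simp only [Pi.add_apply, hf, hg, qSeries_add (ha _) (hb _), mul_add, sum_add_distrib]

lemma mul_const (hf : IsPolySeries N f) (c : ℍ[ℝ]) : IsPolySeries N fun q => f q * c := by
  obtain ⟨a, ha, hf⟩ := hf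
  refine ⟨fun k n => a k n * c, fun k => (ha k).mul_const c, fun q => ?_⟩
  simp only [hf, qSeries_mul_const, sum_mul, mul_assoc]

lemma contDiff (hf : IsPolySeries N f) : ContDiff ℝ (⊤ : ℕ∞) f := by
  obtain ⟨a, ha, hf⟩ := hf
  rw [funext hf]
  refine ContDiff.sum fun k _ => ?_
  have h1 : ContDiff ℝ (⊤ : ℕ∞) fun q : ℍ[ℝ] => star q :=
    (LinearMap.toContinuousLinearMap (starLinear : ℍ[ℝ] →ₗ[ℝ] ℍ[ℝ])).contDiff
  exact (h1.pow k).mul ((ha k).contDiff.of_le le_top)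

lemma continuous (hf : IsPolySeries N f) : Continuous f := hf.contDiff.continuous

/-- The real and imaginary parts of `conj z ^ k * z ^ n`, combined with the coefficients, give the
two stem functions. -/
lemma isSliceFunction (hf : IsPolySeries N f) : IsSliceFunction f := by
  obtain ⟨a, ha, hf⟩ := hf
  let u : ℝ → ℝ → ℕ → ℕ → ℂ := fun x y k n => conj (⟨x, y⟩ : ℂ) ^ k * (⟨x, y⟩ : ℂ) ^ n
  have hu : ∀ x y k n, u x (-y) k n = conj (u x y k n) := fun x y k n => by
    have h1 : (⟨x, -y⟩ : ℂ) = conj (⟨x, y⟩ : ℂ) := rfl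
    simp only [u, h1, map_mul, map_pow, Complex.conj_conj]
  have hs : ∀ x y k, Summable fun n => ‖u x y k n‖ * ‖a k n‖ := fun x y k => by
    refine ((ha k ‖(⟨x, y⟩ : ℂ)‖ (norm_nonneg _)).mul_left (‖(⟨x, y⟩ : ℂ)‖ ^ k)).congr fun n => ?_
    simp only [u, norm_mul, norm_pow, RCLike.norm_conj]
    ring
  have hre : ∀ x y k, Summable fun n => ((u x y k n).re : ℍ[ℝ]) * a k n := fun x y k =>
    Summable.of_norm_bounded (hs x y k) fun n => by
      rw [norm_mul, Quaternion.norm_coe]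
      exact mul_le_mul_of_nonneg_right (Complex.abs_re_le_norm _) (norm_nonneg _)
  have him : ∀ x y k, Summable fun n => ((u x y k n).im : ℍ[ℝ]) * a k n := fun x y k =>
    Summable.of_norm_bounded (hs x y k) fun n => by
      rw [norm_mul, Quaternion.norm_coe]
      exact mul_le_mul_of_nonneg_right (Complex.abs_im_le_norm _) (norm_nonneg _)
  refine ⟨fun x y => ∑ k ∈ range N, ∑' n, ((u x y k n).re : ℍ[ℝ]) * a k n,
    fun x y => ∑ k ∈ range N, ∑' n, ((u x y k n).im : ℍ[ℝ]) * a k n, fun x y => ?_, fun x y => ?_,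
    fun I hI x y => ?_⟩
  · simp only [hu, Complex.conj_re]
  · simp only [hu, Complex.conj_im, Quaternion.coe_neg, neg_mul, tsum_neg, sum_neg_distrib]
  · rw [hf, mul_sum, ← sum_add_distrib]
    refine sum_congr rfl fun k _ => ?_
    rw [slicePt_eq_sliceEmb ⟨I, hI⟩, star_sliceEmb, qSeries, ← tsum_mul_left, ← tsum_mul_left,
      ← (hre x y k).tsum_add ((him x y k).mul_left I)]
    refine tsum_congr fun n => ?_
    rw [← mul_assoc, ← map_pow (sliceEmb _), ← map_pow (sliceEmb _), ← map_mul, sliceEmb_apply,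
      add_mul, mul_assoc]

/-- On each slice the power series components restrict to entire functions. -/
lemma isPolyentire_sliceRestrict (hf : IsPolySeries N f) (J : imagUnits) :
    IsPolyentire N (sliceRestrict J f) := by
  obtain ⟨a, ha, hf⟩ := hf
  refine ⟨fun k z => ∑' n, z ^ n • toSlice J (a k n), fun k => ?_, fun z => ?_⟩
  · intro z
    have h1 : DifferentiableOn ℂ (fun z : ℂ => ∑' n, z ^ n • toSlice J (a k n))
        (Metric.ball 0 (‖z‖ + 1)) := by
      refine Complex.differentiableOn_tsum_of_summable_norm (ha k (‖z‖ + 1) (by positivity))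
        (fun n => ?_) Metric.isOpen_ball fun n w hw => ?_
      · exact Differentiable.differentiableOn (by fun_prop)
      · rw [norm_smul, norm_pow, LinearIsometryEquiv.norm_map, mul_comm]
        rw [mem_ball_zero_iff] at hw
        gcongr
    exact h1.differentiableAt (Metric.isOpen_ball.mem_nhds (by simp))
  · rw [sliceRestrict, hf, map_sum]
    refine sum_congr rfl fun k _ => ?_
    rw [star_sliceEmb, ← map_pow, toSlice_sliceEmb_mul, qSeries]
    congr 1
    refine ((toSlice J).toContinuousLinearEquiv.map_tsum).trans (tsum_congr fun n => ?_)
    rw [← map_pow]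
    exact toSlice_sliceEmb_mul J _ _

end IsPolySeries

/-- Every polyanalytic function on a slice extends to the quaternions through the Taylor series of
its components. -/
lemma IsPolyentire.exists_isPolySeries {N : ℕ} {J : imagUnits} {F : ℂ → SliceSpace J}
    (hF : IsPolyentire N F) : ∃ f, IsPolySeries N f ∧ sliceRestrict J f = F := by
  obtain ⟨h, hd, hF⟩ := hF
  have hb : ∀ k, HasFPowerSeriesOnBall (h k) (cauchyPowerSeries (h k) 0 1) 0 ⊤ := fun k => by
    simpa using (hd k).hasFPowerSeriesOnBall 0 (R := 1) one_pos
  let b : ℕ → ℕ → SliceSpace J := fun k n => (cauchyPowerSeries (h k) 0 1).coeff n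
  have hsum : ∀ k z, HasSum (fun n => z ^ n • b k n) (h k z) := fun k z => by
    have := (hb k).hasSum (y := z) (by simp)
    simpa only [FormalMultilinearSeries.apply_eq_pow_smul_coeff, zero_add] using this
  let a : ℕ → ℕ → ℍ[ℝ] := fun k n => (toSlice J).symm (b k n)
  refine ⟨fun q => ∑ k ∈ range N, star q ^ k * qSeries (a k) q, ⟨a, fun k r hr => ?_,
    fun _ => rfl⟩, ?_⟩
  · have h1 := (cauchyPowerSeries (h k) 0 1).radius_eq_top_iff_summable_norm.1
      (top_le_iff.1 (hb k).r_le) ⟨r, hr⟩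
    refine h1.congr fun n => ?_
    rw [FormalMultilinearSeries.norm_apply_eq_norm_coef]
    simp only [a, LinearIsometryEquiv.norm_map]
    rfl
  · ext1 z
    rw [sliceRestrict, map_sum, hF]
    refine sum_congr rfl fun k _ => ?_
    rw [star_sliceEmb, ← map_pow, toSlice_sliceEmb_mul, qSeries, ← (hsum k z).tsum_eq]
    congr 1
    refine ((toSlice J).toContinuousLinearEquiv.map_tsum).trans (tsum_congr fun n => ?_)
    rw [← map_pow]
    exact toSlice_sliceEmb_mul J _ _

/-- The representation formula: a slice function is determined by its values on one slice. -/
lemma IsSliceFunction.eq_of_slice {f : ℍ[ℝ] → ℍ[ℝ]} (hf : IsSliceFunction f) (J K : imagUnits)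
    (z : ℂ) : f (sliceEmb K z) =
      (1 / 2 : ℝ) • (f (sliceEmb J z) + f (sliceEmb J (conj z))) -
        (K : ℍ[ℝ]) * J * (1 / 2 : ℝ) • (f (sliceEmb J z) - f (sliceEmb J (conj z))) := by
  obtain ⟨α, β, hα, hβ, h⟩ := hf
  have h1 : ∀ (L : imagUnits) (z : ℂ), f (sliceEmb L z) = α z.re z.im + L * β z.re z.im :=
    fun L z => by rw [← h L L.2, slicePt_eq_sliceEmb]
  have h2 : (1 / 2 : ℝ) • (α z.re z.im + J * β z.re z.im + (α z.re z.im + J * -β z.re z.im)) =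
      α z.re z.im := by
    rw [mul_neg]
    module
  have h3 : (1 / 2 : ℝ) • (α z.re z.im + J * β z.re z.im - (α z.re z.im + J * -β z.re z.im)) =
      J * β z.re z.im := by
    rw [mul_neg]
    module
  rw [h1, h1, h1, Complex.conj_re, Complex.conj_im, hα, hβ, h2, h3, mul_assoc,
    ← mul_assoc (J : ℍ[ℝ]),
    mul_self_of_mem_imagUnits J.2]
  simp

lemma IsSliceFunction.ext_of_sliceRestrict {f g : ℍ[ℝ] → ℍ[ℝ]} (hf : IsSliceFunction f)
    (hg : IsSliceFunction g) {J : imagUnits} (h : sliceRestrict J f = sliceRestrict J g) :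
    f = g := by
  have h1 : ∀ z, f (sliceEmb J z) = g (sliceEmb J z) := fun z => congrFun h z
  ext1 q
  obtain ⟨K, z, rfl⟩ := exists_eq_sliceEmb q
  rw [hf.eq_of_slice J K, hg.eq_of_slice J K, h1, h1]

/-- Slice polyanalytic functions of order `N` are exactly the sums of `N` quaternionic power series
multiplied by powers of the conjugate variable. -/
theorem isSlicePolyanalytic_iff {N : ℕ} {f : ℍ[ℝ] → ℍ[ℝ]} :
    IsSlicePolyanalytic N f ↔ IsPolySeries N f := by
  constructor
  · rintro ⟨hs, hd, h0⟩
    obtain ⟨J, -, -⟩ := exists_eq_sliceEmb 0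
    have hS := (dirDiff_of_differentiable_iteratedFDeriv hd).sliceRestrict J
    have hD := hS.differentiable_wirtinger_iterate
    have hP := isPolyentire_of_wirtinger_iterate_eq_zero N hD
      ((dbar_iterate_eq_zero_iff J hD).1 (h0 J J.2))
    obtain ⟨g, hg, hgf⟩ := hP.exists_isPolySeries
    rwa [hs.ext_of_sliceRestrict hg.isSliceFunction hgf.symm]
  · intro hf
    refine ⟨hf.isSliceFunction, fun m _ => hf.contDiff.differentiable_iteratedFDeriv
      (by exact_mod_cast ENat.natCast_lt_top m), fun J hJ => ?_⟩
    have hP := hf.isPolyentire_sliceRestrict ⟨J, hJ⟩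
    refine (dbar_iterate_eq_zero_iff ⟨J, hJ⟩ fun m hm => ?_).2 fun z => ?_
    · exact (hP.wirtinger_iterate m hm.le).contDiff.differentiable (by simp)
    · obtain ⟨h, -, hz⟩ := hP.wirtinger_iterate N le_rfl
      rw [hz z]
      simp

end PowerSeries

/-! ### The Fock space -/

section Fock

open MeasureTheory Filter

variable (J : imagUnits)

/-- The squared norm density of a function on a slice, in the complex coordinate. -/
def fockDensity (f : ℍ[ℝ] → ℍ[ℝ]) (z : ℂ) : ℝ :=
  ‖sliceRestrict J f z‖ ^ 2 * Real.exp (-‖z‖ ^ 2)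

lemma fockDensity_nonneg (f : ℍ[ℝ] → ℍ[ℝ]) (z : ℂ) : 0 ≤ fockDensity J f z := by
  unfold fockDensity
  positivity

lemma fockDensity_measurableEquiv_symm (f : ℍ[ℝ] → ℍ[ℝ]) (p : ℝ × ℝ) :
    fockDensity J f (Complex.measurableEquivRealProd.symm p) =
      ‖f (slicePt J p.1 p.2)‖ ^ 2 * Real.exp (-‖slicePt J p.1 p.2‖ ^ 2) := by
  rw [slicePt_eq_sliceEmb, norm_sliceEmb]
  rfl

variable {J}

lemma mem_fockSpace_iff {N : ℕ} {f : ℍ[ℝ] → ℍ[ℝ]} :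
    f ∈ fockSpace N J ↔ IsPolySeries N f ∧ Integrable (fockDensity J f) := by
  have h := (Complex.volume_preserving_equiv_real_prod.symm).integrable_comp_emb
    Complex.measurableEquivRealProd.symm.measurableEmbedding (g := fockDensity J f)
  have h2 : fockDensity J f ∘ Complex.measurableEquivRealProd.symm = fun p : ℝ × ℝ =>
      ‖f (slicePt J p.1 p.2)‖ ^ 2 * Real.exp (-‖slicePt J p.1 p.2‖ ^ 2) :=
    funext fun p => fockDensity_measurableEquiv_symm J f p
  rw [h2] at h
  rw [← h, ← isSlicePolyanalytic_iff]
  rfl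

lemma fockInner_self (f : ℍ[ℝ] → ℍ[ℝ]) :
    fockInner J f f = (∫ z, fockDensity J f z) • (1 : ℍ[ℝ]) := by
  rw [← (Complex.volume_preserving_equiv_real_prod.symm).integral_comp
    Complex.measurableEquivRealProd.symm.measurableEmbedding, ← integral_smul_const]
  refine integral_congr_ae (Eventually.of_forall fun p => ?_)
  dsimp only
  have h : ∀ x : ℝ, x • (1 : ℍ[ℝ]) = (x : ℍ[ℝ]) := fun x => by
    rw [Algebra.smul_def, mul_one]
    rfl
  rw [fockDensity_measurableEquiv_symm, fockIntegrand, Quaternion.star_mul_self,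
    Quaternion.normSq_eq_norm_mul_self, h, ← Quaternion.coe_smul, smul_eq_mul]
  congr 1
  ring

lemma ipNorm_fockInner (f : ℍ[ℝ] → ℍ[ℝ]) :
    ipNorm (fockInner J) f = Real.sqrt (∫ z, fockDensity J f z) := by
  rw [ipNorm, fockInner_self]
  simp

lemma ipNorm_fockInner_sq (f : ℍ[ℝ] → ℍ[ℝ]) :
    ipNorm (fockInner J) f ^ 2 = ∫ z, fockDensity J f z := by
  rw [ipNorm_fockInner, Real.sq_sqrt (integral_nonneg (fockDensity_nonneg J f))]

lemma continuous_fockDensity {N : ℕ} {f : ℍ[ℝ] → ℍ[ℝ]} (hf : IsPolySeries N f) :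
    Continuous (fockDensity J f) := by
  have h := (hf.isPolyentire_sliceRestrict J).continuous
  unfold fockDensity
  fun_prop

lemma norm_sq_sliceEmb_le {N : ℕ} (hN : 1 ≤ N) {f : ℍ[ℝ] → ℍ[ℝ]} (hf : f ∈ fockSpace N J)
    (z : ℂ) : ‖f (sliceEmb J z)‖ ^ 2 ≤
      N / Real.pi * Real.exp (‖z‖ ^ 2) * ipNorm (fockInner J) f ^ 2 := by
  rw [mem_fockSpace_iff] at hf
  rw [ipNorm_fockInner_sq]
  exact (hf.1.isPolyentire_sliceRestrict J).norm_sq_le hN hf.2 z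

/-- By the representation formula and the parallelogram law, `|f q| ^ 2` is at most the sum of the
squares of `|f|` at the two points of the slice with the real part and modulus of `q`. The factor
`2` lost here is absorbed by the factor `1 / π` of the bound on the slice. -/
lemma norm_le_of_mem_fockSpace {N : ℕ} (hN : 1 ≤ N) {f : ℍ[ℝ] → ℍ[ℝ]} (hf : f ∈ fockSpace N J)
    (q : ℍ[ℝ]) :
    ‖f q‖ ≤ Real.sqrt N * Real.exp (‖q‖ ^ 2 / 2) * ipNorm (fockInner J) f := by
  have hn : 0 ≤ ipNorm (fockInner J) f := Real.sqrt_nonneg _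
  obtain ⟨K, z, rfl⟩ := exists_eq_sliceEmb q
  refine le_of_sq_le_sq ?_ (by positivity)
  have h1 := norm_sq_sliceEmb_le hN hf z
  have h2 := norm_sq_sliceEmb_le hN hf (conj z)
  rw [RCLike.norm_conj] at h2
  set a := f (sliceEmb J z)
  set b := f (sliceEmb J (conj z))
  have h3 : ‖f (sliceEmb K z)‖ ≤ (‖a + b‖ + ‖a - b‖) / 2 := by
    rw [hf.1.1.eq_of_slice J K z]
    refine (norm_sub_le _ _).trans (le_of_eq ?_)
    rw [norm_mul, norm_mul, norm_of_mem_imagUnits K.2, norm_of_mem_imagUnits J.2, norm_smul,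
      norm_smul]
    norm_num
    ring
  have h4 := parallelogram_law_with_norm ℝ a b
  have h5 : ‖f (sliceEmb K z)‖ ^ 2 ≤ ‖a‖ ^ 2 + ‖b‖ ^ 2 := by
    have h6 := pow_le_pow_left₀ (norm_nonneg _) h3 2
    nlinarith [sq_nonneg (‖a + b‖ - ‖a - b‖)]
  have h6 : Real.exp (‖z‖ ^ 2 / 2) ^ 2 = Real.exp (‖z‖ ^ 2) := by
    rw [← Real.exp_nat_mul]
    congr 1
    push_cast
    ring
  rw [mul_pow, mul_pow, norm_sliceEmb, h6, Real.sq_sqrt (Nat.cast_nonneg N)]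
  have h7 : 2 * ((N : ℝ) / Real.pi) ≤ N := by
    rw [← mul_div_assoc, div_le_iff₀ Real.pi_pos]
    nlinarith [Real.pi_gt_three, Nat.cast_nonneg (α := ℝ) N]
  have h8 := mul_le_mul_of_nonneg_right h7
    (show 0 ≤ Real.exp (‖z‖ ^ 2) * ipNorm (fockInner J) f ^ 2 by positivity)
  linarith

lemma add_mem_fockSpace {N : ℕ} {f g : ℍ[ℝ] → ℍ[ℝ]} (hf : f ∈ fockSpace N J)
    (hg : g ∈ fockSpace N J) : f + g ∈ fockSpace N J := by
  rw [mem_fockSpace_iff] at *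
  refine ⟨hf.1.add hg.1, ((hf.2.const_mul 2).add (hg.2.const_mul 2)).mono'
    (continuous_fockDensity (hf.1.add hg.1)).aestronglyMeasurable
    (Eventually.of_forall fun z => ?_)⟩
  rw [Real.norm_of_nonneg (fockDensity_nonneg _ _ _)]
  simp only [fockDensity, norm_sliceRestrict, Pi.add_apply]
  rw [← mul_assoc, ← mul_assoc, ← add_mul]
  refine mul_le_mul_of_nonneg_right ?_ (Real.exp_pos _).le
  have h := pow_le_pow_left₀ (norm_nonneg _) (norm_add_le (f (sliceEmb J z)) (g (sliceEmb J z))) 2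
  nlinarith [sq_nonneg (‖f (sliceEmb J z)‖ - ‖g (sliceEmb J z)‖)]

lemma mul_const_mem_fockSpace {N : ℕ} {f : ℍ[ℝ] → ℍ[ℝ]} (hf : f ∈ fockSpace N J) (c : ℍ[ℝ]) :
    (fun q => f q * c) ∈ fockSpace N J := by
  rw [mem_fockSpace_iff] at *
  refine ⟨hf.1.mul_const c, (hf.2.const_mul (‖c‖ ^ 2)).congr (Eventually.of_forall fun z => ?_)⟩
  simp only [fockDensity, norm_sliceRestrict, norm_mul]
  ring

variable (J) in
/-- The Fock space as a submodule of the right quaternionic vector space of all functions. -/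
def fockSubmodule (N : ℕ) : Submodule ℍ[ℝ]ᵐᵒᵖ (ℍ[ℝ] → ℍ[ℝ]) where
  carrier := fockSpace N J
  add_mem' := add_mem_fockSpace
  zero_mem' := mem_fockSpace_iff.2 ⟨IsPolySeries.zero N, (integrable_zero ℂ ℝ volume).congr
    (Eventually.of_forall fun z => by simp [fockDensity, norm_sliceRestrict])⟩
  smul_mem' c _ hf := mul_const_mem_fockSpace hf c.unop

lemma sub_mem_fockSpace {N : ℕ} {f g : ℍ[ℝ] → ℍ[ℝ]} (hf : f ∈ fockSpace N J)
    (hg : g ∈ fockSpace N J) : f - g ∈ fockSpace N J :=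
  (fockSubmodule J N).sub_mem hf hg

lemma integrable_fockIntegrand {N : ℕ} {f g : ℍ[ℝ] → ℍ[ℝ]} (hf : f ∈ fockSpace N J)
    (hg : g ∈ fockSpace N J) : Integrable (fockIntegrand J f g) := by
  have hfc := (mem_fockSpace_iff.1 hf).1.continuous
  have hgc := (mem_fockSpace_iff.1 hg).1.continuous
  have hc : Continuous fun p : ℝ × ℝ => slicePt J p.1 p.2 := by
    have := Quaternion.continuous_coe
    unfold slicePt
    fun_prop
  have hm : Continuous (fockIntegrand J f g) := by
    unfold fockIntegrand
    fun_prop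
  refine (hf.2.add hg.2).mono' hm.aestronglyMeasurable (Eventually.of_forall fun p => ?_)
  simp only [fockIntegrand, norm_smul, norm_mul, norm_star, Real.norm_of_nonneg (Real.exp_pos _).le,
    Pi.add_apply, ← add_mul]
  rw [mul_comm]
  refine mul_le_mul_of_nonneg_right ?_ (Real.exp_pos _).le
  nlinarith [sq_nonneg (‖f (slicePt J p.1 p.2)‖ - ‖g (slicePt J p.1 p.2)‖),
    sq_nonneg ‖f (slicePt J p.1 p.2)‖, sq_nonneg ‖g (slicePt J p.1 p.2)‖]

/-- If `v n` converges pointwise on the slice to `f`, then the norm bounds of the `v n`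
pass to `f` by Fatou's lemma. -/
lemma mem_fockSpace_of_tendsto {N : ℕ} {v : ℕ → ℍ[ℝ] → ℍ[ℝ]} (hv : ∀ n, v n ∈ fockSpace N J)
    {f : ℍ[ℝ] → ℍ[ℝ]} (hf : IsPolySeries N f)
    (hlim : ∀ z, Tendsto (fun n => v n (sliceEmb J z)) atTop (𝓝 (f (sliceEmb J z)))) {C : ℝ}
    (hC : ∀ᶠ n in atTop, ipNorm (fockInner J) (v n) ≤ C) :
    f ∈ fockSpace N J ∧ ipNorm (fockInner J) f ≤ C := by
  have hC0 : 0 ≤ C := by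
    obtain ⟨n, hn⟩ := hC.exists
    exact (Real.sqrt_nonneg _).trans hn
  have hv' := fun n => mem_fockSpace_iff.1 (hv n)
  have h1 : ∫⁻ z, ENNReal.ofReal (fockDensity J f z) ≤ ENNReal.ofReal (C ^ 2) := by
    have h2 : ∀ z, ENNReal.ofReal (fockDensity J f z) =
        liminf (fun n => ENNReal.ofReal (fockDensity J (v n) z)) atTop := fun z => by
      refine (Tendsto.liminf_eq ?_).symm
      refine (ENNReal.continuous_ofReal.tendsto _).comp ?_
      exact ((hlim z).norm.pow 2).mul_const _
    simp only [h2]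
    refine (lintegral_liminf_le fun n =>
      (continuous_fockDensity (hv' n).1).measurable.ennreal_ofReal).trans ?_
    refine (liminf_le_liminf (hC.mono fun n hn => ?_)).trans_eq (liminf_const _)
    rw [← ofReal_integral_eq_lintegral_ofReal (hv' n).2
      (Eventually.of_forall (fockDensity_nonneg J _)), ← ipNorm_fockInner_sq]
    exact ENNReal.ofReal_le_ofReal (pow_le_pow_left₀ (Real.sqrt_nonneg _) hn 2)
  have h2 : Integrable (fockDensity J f) := by
    refine ⟨(continuous_fockDensity hf).aestronglyMeasurable, ?_⟩
    rw [hasFiniteIntegral_iff_ofReal (Eventually.of_forall (fockDensity_nonneg J f))]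
    exact h1.trans_lt ENNReal.ofReal_lt_top
  refine ⟨mem_fockSpace_iff.2 ⟨hf, h2⟩, ?_⟩
  rw [← ofReal_integral_eq_lintegral_ofReal h2 (Eventually.of_forall (fockDensity_nonneg J f)),
    ENNReal.ofReal_le_ofReal_iff (by positivity), ← ipNorm_fockInner_sq] at h1
  exact le_of_sq_le_sq h1 hC0

/-- Cauchy sequences for the norm are uniformly Cauchy on discs of the slice; their pointwise limits
there are polyanalytic, and extend to the quaternions. -/
theorem exists_tendsto_of_cauchy {N : ℕ} (hN : 1 ≤ N) {u : ℕ → ℍ[ℝ] → ℍ[ℝ]}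
    (hu : ∀ n, u n ∈ fockSpace N J)
    (hcau : ∀ ε : ℝ, 0 < ε → ∃ M : ℕ, ∀ m ≥ M, ∀ n ≥ M,
      ipNorm (fockInner J) (u m - u n) < ε) :
    ∃ f ∈ fockSpace N J, Tendsto (fun n => ipNorm (fockInner J) (u n - f)) atTop (𝓝 0) := by
  have hP := fun n => (mem_fockSpace_iff.1 (hu n)).1
  obtain ⟨G, hG, hlim⟩ := IsPolyentire.exists_tendsto
    (fun n => (hP n).isPolyentire_sliceRestrict J) (fun R => by
      rw [Metric.uniformCauchySeqOn_iff]
      intro ε hε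
      have hA : 0 < Real.sqrt N * Real.exp (R ^ 2 / 2) := by
        have : (0 : ℝ) < N := by exact_mod_cast hN
        positivity
      obtain ⟨M, hM⟩ := hcau (ε / (Real.sqrt N * Real.exp (R ^ 2 / 2))) (by positivity)
      refine ⟨M, fun m hm n hn z hz => ?_⟩
      have h1 := norm_le_of_mem_fockSpace hN (sub_mem_fockSpace (hu m) (hu n)) (sliceEmb J z)
      have h2 := hM m hm n hn
      rw [lt_div_iff₀ hA] at h2
      rw [norm_sliceEmb] at h1
      rw [mem_closedBall_zero_iff] at hz
      have h3 : Real.exp (‖z‖ ^ 2 / 2) ≤ Real.exp (R ^ 2 / 2) := by gcongr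
      have h4 : 0 ≤ ipNorm (fockInner J) (u m - u n) := Real.sqrt_nonneg _
      have h5 : dist (sliceRestrict J (u m) z) (sliceRestrict J (u n) z) =
          ‖(u m - u n) (sliceEmb J z)‖ := dist_eq_norm _ _
      rw [h5]
      refine (h1.trans ?_).trans_lt h2
      rw [mul_comm (ipNorm _ _)]
      gcongr)
  obtain ⟨f, hf, rfl⟩ := hG.exists_isPolySeries
  have hlim' : ∀ z, Tendsto (fun n => u n (sliceEmb J z)) atTop (𝓝 (f (sliceEmb J z))) := hlim
  have key : ∀ ε > 0, ∃ M, ∀ n ≥ M,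
      u n - f ∈ fockSpace N J ∧ ipNorm (fockInner J) (u n - f) ≤ ε := by
    intro ε hε
    obtain ⟨M, hM⟩ := hcau ε hε
    refine ⟨M, fun n hn => ?_⟩
    refine mem_fockSpace_of_tendsto (v := fun m => u n - u m)
      (fun m => sub_mem_fockSpace (hu n) (hu m)) ?_ (fun z => ?_) ?_
    · have h1 : u n - f = u n + fun q => f q * (-1) := by
        ext1 q
        simp [sub_eq_add_neg]
      rw [h1]
      exact (hP n).add (hf.mul_const (-1))
    · exact tendsto_const_nhds.sub (hlim' z)
    · filter_upwards [eventually_ge_atTop M] with m hm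
      exact (hM n hn m hm).le
  refine ⟨f, ?_, ?_⟩
  · obtain ⟨M, hM⟩ := key 1 one_pos
    have h1 := sub_mem_fockSpace (hu M) (hM M le_rfl).1
    rwa [sub_sub_cancel] at h1
  · rw [Metric.tendsto_atTop]
    intro ε hε
    obtain ⟨M, hM⟩ := key (ε / 2) (by positivity)
    refine ⟨M, fun n hn => ?_⟩
    have h1 : 0 ≤ ipNorm (fockInner J) (u n - f) := Real.sqrt_nonneg _
    rw [Real.dist_eq, sub_zero, abs_of_nonneg h1]
    linarith [(hM n hn).2]

theorem isRightHilbertSpace_fockSubmodule {N : ℕ} (hN : 1 ≤ N) :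
    IsRightHilbertSpace (fockSubmodule J N)
      (fun f g => fockInner J (f : ℍ[ℝ] → ℍ[ℝ]) (g : ℍ[ℝ] → ℍ[ℝ])) where
  add_left u v w := by
    simp only [fockInner]
    rw [← integral_add (integrable_fockIntegrand u.2 w.2) (integrable_fockIntegrand v.2 w.2)]
    refine integral_congr_ae (Eventually.of_forall fun p => ?_)
    simp [fockIntegrand, mul_add]
  smul_left a u w := by
    simp only [fockInner]
    let L : ℍ[ℝ] →L[ℝ] ℍ[ℝ] := (ContinuousLinearMap.mul ℝ ℍ[ℝ]).flip a
    refine Eq.trans ?_ (L.integral_comp_comm (integrable_fockIntegrand u.2 w.2))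
    refine integral_congr_ae (Eventually.of_forall fun p => ?_)
    simp [fockIntegrand, L, mul_assoc]
  conj_symm u v := by
    simp only [fockInner]
    let L : ℍ[ℝ] →L[ℝ] ℍ[ℝ] := LinearMap.toContinuousLinearMap starLinear
    refine (L.integral_comp_comm (integrable_fockIntegrand u.2 v.2)).symm.trans ?_
    refine integral_congr_ae (Eventually.of_forall fun p => ?_)
    change star _ = _
    simp [fockIntegrand, Quaternion.star_smul]
  nonneg u := by
    rw [fockInner_self]
    simpa using integral_nonneg (fockDensity_nonneg J u)
  definite u hu := by
    ext1
    ext1 q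
    have h1 := norm_le_of_mem_fockSpace hN u.2 q
    have h2 : ipNorm (fockInner J) (u : ℍ[ℝ] → ℍ[ℝ]) = 0 := by
      rw [ipNorm, hu]
      simp
    rw [h2, mul_zero] at h1
    exact norm_le_zero_iff.1 h1
  complete u hu := by
    obtain ⟨f, hf, hlim⟩ := exists_tendsto_of_cauchy hN (fun n => (u n).2) hu
    exact ⟨⟨f, hf⟩, hlim⟩

end Fock
end SliceFock
end

theorem mainTheorem7 (N : ℕ) (hN : 1 ≤ N) (I : ℍ[ℝ]) (hI : I ∈ SliceFock.imagUnits) :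
    (∀ f ∈ SliceFock.fockSpace N I, ∀ g ∈ SliceFock.fockSpace N I,
      MeasureTheory.Integrable (SliceFock.fockIntegrand I f g) MeasureTheory.volume) ∧
    (∃ H : Submodule ℍ[ℝ]ᵐᵒᵖ (ℍ[ℝ] → ℍ[ℝ]),
      (H : Set (ℍ[ℝ] → ℍ[ℝ])) = SliceFock.fockSpace N I ∧
      SliceFock.IsRightHilbertSpace H
        (fun f g => SliceFock.fockInner I (f : ℍ[ℝ] → ℍ[ℝ]) (g : ℍ[ℝ] → ℍ[ℝ]))) ∧
    (∀ f ∈ SliceFock.fockSpace N I, ∀ q : ℍ[ℝ],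
      ‖f q‖ ≤ Real.sqrt N * Real.exp (‖q‖ ^ 2 / 2) *
        SliceFock.ipNorm (SliceFock.fockInner I) f) :=
  ⟨fun _ hf _ hg => SliceFock.integrable_fockIntegrand (J := ⟨I, hI⟩) hf hg,
    ⟨SliceFock.fockSubmodule ⟨I, hI⟩ N, rfl,
      SliceFock.isRightHilbertSpace_fockSubmodule (J := ⟨I, hI⟩) hN⟩,
    fun _ hf q => SliceFock.norm_le_of_mem_fockSpace (J := ⟨I, hI⟩) hN hf q⟩
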